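/- Let $\mathbb K$ be an algebraically closed field of characteristic zero and let $\omega\in\mathbb R^N$ have rationally independent coordinates. Write $\mathbb K[x^*,y]=\mathbb K[x_1^{\pm1},\dots,x_N^{\pm1}][y_1,\dots,y_M]$. *Admissible ideals and $\omega$-solutions.* An ideal $\mathcal I\subset\mathbb K[x^*,y]$ is $N$-admissible if the projection $(x,y)\mapsto x$ from the zero set of $\mathcal I\cap\mathbb K[x,y]$ in $\mathbb K^{N+M}$ to $\mathbb K^N$ is dominant with finite generic fibre. Let $S_\omega$ be the field of $\omega$-positive Puiseux series: series $\sum_{\alpha\in\mathbb Q^N}c_\alpha x^\alpha$ whose set of exponents is contained in $\frac1k\mathbb Z^N$ for some integer $k\ge 1$ and in a translate (by a vector of $\mathbb Q^N$) of a convex rational polyhedral cone $\sigma$ with $\omega\cdot v\ge 0$ for all $v\in\sigma$. An $\omega$-solution of $\mathcal I$ is a common zero in $S_\omega^M$ of the extension of $\mathcal I$ to $S_\omega[y]$. *Initial ideals.* Let $\eta\in(\mathbb R\cup\{\infty\})^M$, with $\infty\cdot 0=0$ and $\infty\cdot a=\infty$ for $a\ne 0$, and put $\Lambda(\eta)=\{i:\eta_i\neq\infty\}$.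 The $(\omega,\eta)$-order of $f=\sum a_{\alpha,\beta}x^\alpha y^\beta\in\mathbb K[x^*,y]$ is the minimum of $\omega\cdot\alpha+\eta\cdot\beta$ over its terms; its initial part is the sum of the terms attaining the minimum, or $0$ if the order is $\infty$. The initial ideal $\mathrm{In}_{\omega,\eta}\mathcal I$ is generated by the initial parts of all $f\in\mathcal I$ together with the $y_i$, $i\notin\Lambda(\eta)$. The pair $(\omega,\eta)$ is in the tropical variety of $\mathcal I$ if $\mathrm{In}_{\omega,\eta}\mathcal I$ contains no monomial $cx^\alpha y^\beta$, $c\in\mathbb K^*$, in the variables $x$ and $y_i$, $i\in\Lambda(\eta)$. *$\omega$-sets.* An $\omega$-set is a triple $D=\{\eta,\Gamma,c\}$ with $\eta\in(\mathbb R\cup\{\infty\})^M$, $\Gamma$ an $M\times N$ matrix over $\mathbb Q\cup\{\infty\}$ and $c\in\mathbb K^M$, such that $\omega\cdot\Gamma^T=\eta$, the $i$-th row of $\Gamma$ is $(\infty,\dots,\infty)$ when $\eta_i=\infty$, and $c_i\ne0$ if and only if $\eta_i\neq\infty$. Let $\mathfrak M_D(x)=(c_1x^{\Gamma_{1,*}},\dots,c_Mx^{\Gamma_{M,*}})$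 (with entry $0$ when $c_i=0$), let $\mathbf d\Gamma$ be the least common multiple of the denominators of the finite entries of $\Gamma$, and write $x^{rI}=(x_1^r,\dots,x_N^r)$. The set $D$ is a starting $\omega$-set for $\mathcal I$ if $(\omega,\eta)$ is in the tropical variety of $\mathcal I$ and $f(\underline 1,c)=0$ for all $f\in\mathrm{In}_{\omega,\eta}\mathcal I$. Let $\mathcal I_D\subset\mathbb K[x^*,y]$ be the ideal generated by all $f(x^{\mathbf d\Gamma I},\,y+\mathfrak M_D(x^{\mathbf d\Gamma I}))$ with $f\in\mathcal I$. *$\omega$-sequences.* Given $S=\{D^{(i)}\}_{i=0}^\infty$ with $D^{(i)}=\{\eta^{(i)},\Gamma^{(i)},c^{(i)}\}$, put $\mathcal I^{(0)}=\mathcal I$ and $\mathcal I^{(i)}=\mathcal I^{(i-1)}_{D^{(i-1)}}$ for $i\geq1$. Then $S$ is an (infinite) $\omega$-sequence for $\mathcal I$ if every $D^{(i)}$ is a starting $\omega$-set for $\mathcal I^{(i)}$ and, for all $i\ge1$ and all $j$ with $\eta^{(i)}_j\neq\infty$, one has $\eta^{(i)}_j>\mathbf d\Gamma^{(i-1)}\,\eta^{(i-1)}_j$.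 Put $r^{(0)}=1$, $r^{(i)}=1/\prod_{j=0}^{i-1}\mathbf d\Gamma^{(j)}$ and $$\mathbf{ser}(S)=\sum_{i=0}^\infty\mathfrak M_{D^{(i)}}\bigl(x^{r^{(i)}I}\bigr).$$ **Theorem.** Let $\mathcal I\subset\mathbb K[x^*,y]$ be an $N$-admissible ideal and let $S=\{D^{(i)}\}_{i=0}^\infty$ be an $\omega$-sequence for $\mathcal I$. Then the sum $\mathbf{ser}(S)$ is well defined (in each coordinate, every exponent occurs in only finitely many summands), and $\mathbf{ser}(S)$ is an $\omega$-solution of $\mathcal I$; in particular $\mathbf{ser}(S)\in S_\omega^M$. -/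

import Mathlib

noncomputable section

namespace OmegaPuiseux

/-! ### Exponents ordered by `ω` -/

/-- The group `ℚ^N` of exponents, totally ordered by `α ≤ α' ↔ ω · α ≤ ω · α'`. -/
@[ext]
structure Expo {N : ℕ} (ω : Fin N → ℝ) (hω : LinearIndependent ℚ ω) : Type where
  /-- The underlying vector of `ℚ^N`. -/
  vec : Fin N → ℚ

section Expo

variable {N : ℕ} (ω : Fin N → ℝ) (hω : LinearIndependent ℚ ω)

/-- The tautological bijection of `Expo ω hω` with `ℚ^N`. -/
def expoEquiv : Expo ω hω ≃ (Fin N → ℚ) where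
  toFun := Expo.vec
  invFun := Expo.mk
  left_inv _ := rfl
  right_inv _ := rfl

instance : AddCommGroup (Expo ω hω) := (expoEquiv ω hω).addCommGroup

/-- The identification of `ℚ^N` with the ordered group of exponents. -/
def toExpo : (Fin N → ℚ) ≃+ Expo ω hω := (expoEquiv ω hω).addEquiv.symm

/-- The real number `ω · α`. -/
def dot : Expo ω hω →+ ℝ where
  toFun α := ∑ j, ω j * (((toExpo ω hω).symm α j : ℚ) : ℝ)
  map_zero' := by simp
  map_add' α β := by simp [mul_add, Finset.sum_add_distrib]

theorem dot_injective : Function.Injective (dot ω hω) := by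
  rw [injective_iff_map_eq_zero]
  intro α h
  have h0 := Fintype.linearIndependent_iff.1 hω ((toExpo ω hω).symm α) (by
    simpa [dot, Rat.smul_def, mul_comm] using h)
  exact (toExpo ω hω).symm.injective (by ext j; simpa using h0 j)

instance : LinearOrder (Expo ω hω) :=
  LinearOrder.lift' (dot ω hω) (dot_injective ω hω)

theorem expo_le_iff {α β : Expo ω hω} : α ≤ β ↔ dot ω hω α ≤ dot ω hω β := Iff.rfl

instance : IsOrderedAddMonoid (Expo ω hω) where
  add_le_add_left α β h γ := by
    rw [expo_le_iff] at h ⊢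
    simpa using h

end Expo

/-! ### Rational cones and the field of `ω`-positive Puiseux series -/

/-- `σ ⊆ ℝ^N` is a convex rational polyhedral cone: the set of all nonnegative real
combinations of finitely many vectors of `ℚ^N`. -/
def IsRationalCone {N : ℕ} (σ : Set (Fin N → ℝ)) : Prop :=
  ∃ V : Set (Fin N → ℚ), V.Finite ∧
    σ = (PointedCone.hull ℝ ((fun (v : Fin N → ℚ) (j : Fin N) => (v j : ℝ)) '' V) :
      Set (Fin N → ℝ))

/-- A cone `σ` is `ω`-positive when `ω · v ≥ 0` for all `v ∈ σ`. -/
def IsPositiveCone {N : ℕ} (ω : Fin N → ℝ) (σ : Set (Fin N → ℝ)) : Prop :=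
  ∀ v ∈ σ, 0 ≤ ∑ j, ω j * v j

/-- The set `E ⊆ ℚ^N` is contained in `(1/k) ℤ^N` for some integer `k > 0`. -/
def InLattice {N : ℕ} (E : Set (Fin N → ℚ)) : Prop :=
  ∃ k : ℕ, 0 < k ∧ ∀ α ∈ E, ∀ j, ∃ z : ℤ, (k : ℚ) * α j = z

/-- Some translate `γ + E` of `E ⊆ ℚ^N`, with `γ ∈ ℚ^N`, is contained in an `ω`-positive
rational cone. -/
def InPositiveCone {N : ℕ} (ω : Fin N → ℝ) (E : Set (Fin N → ℚ)) : Prop :=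
  ∃ (γ : Fin N → ℚ) (σ : Set (Fin N → ℝ)), IsRationalCone σ ∧ IsPositiveCone ω σ ∧
    ∀ α ∈ E, (fun j => ((γ j + α j : ℚ) : ℝ)) ∈ σ

theorem InLattice.mono {N : ℕ} {E F : Set (Fin N → ℚ)} (h : InLattice F) (hE : E ⊆ F) :
    InLattice E := by
  obtain ⟨k, hk, h⟩ := h
  exact ⟨k, hk, fun α hα => h α (hE hα)⟩

theorem InPositiveCone.mono {N : ℕ} {ω : Fin N → ℝ} {E F : Set (Fin N → ℚ)}
    (h : InPositiveCone ω F) (hE : E ⊆ F) : InPositiveCone ω E := by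
  obtain ⟨γ, σ, h1, h2, h⟩ := h
  exact ⟨γ, σ, h1, h2, fun α hα => h α (hE hα)⟩

theorem inLattice_singleton {N : ℕ} (α : Fin N → ℚ) : InLattice ({α} : Set (Fin N → ℚ)) := by
  refine ⟨∏ j, (α j).den, Finset.prod_pos fun j _ => (α j).pos, ?_⟩
  rintro β rfl j
  obtain ⟨m, hm⟩ := Finset.dvd_prod_of_mem (fun j => (β j).den) (Finset.mem_univ j)
  refine ⟨m * (β j).num, ?_⟩
  rw [hm]
  push_cast
  rw [mul_comm ((β j).den : ℚ), mul_assoc, Rat.den_mul_eq_num]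

theorem inPositiveCone_singleton {N : ℕ} (ω : Fin N → ℝ) (α : Fin N → ℚ) :
    InPositiveCone ω {α} := by
  refine ⟨-α, _, ⟨∅, Set.finite_empty, rfl⟩, ?_, ?_⟩
  · intro v hv
    have : v = 0 := by simpa [PointedCone.hull] using hv
    simp [this]
  · rintro _ rfl
    simp only [Pi.neg_apply, neg_add_cancel, Rat.cast_zero]
    exact Submodule.zero_mem _

theorem InLattice.union {N : ℕ} {E F : Set (Fin N → ℚ)} (hE : InLattice E)
    (hF : InLattice F) : InLattice (E ∪ F) := by
  obtain ⟨k, hk, hE⟩ := hE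
  obtain ⟨l, hl, hF⟩ := hF
  refine ⟨k * l, Nat.mul_pos hk hl, ?_⟩
  rintro α (h | h) j
  · obtain ⟨z, hz⟩ := hE α h j
    exact ⟨l * z, by push_cast; rw [← hz]; ring⟩
  · obtain ⟨z, hz⟩ := hF α h j
    exact ⟨k * z, by push_cast; rw [← hz]; ring⟩

open Pointwise in
theorem InLattice.add {N : ℕ} {E F : Set (Fin N → ℚ)} (hE : InLattice E)
    (hF : InLattice F) : InLattice (E + F) := by
  obtain ⟨k, hk, hE⟩ := hE
  obtain ⟨l, hl, hF⟩ := hF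
  refine ⟨k * l, Nat.mul_pos hk hl, ?_⟩
  rintro _ ⟨α, hα, β, hβ, rfl⟩ j
  obtain ⟨z, hz⟩ := hE α hα j
  obtain ⟨w, hw⟩ := hF β hβ j
  exact ⟨l * z + k * w, by push_cast; rw [← hz, ← hw, Pi.add_apply]; ring⟩

theorem isPositiveCone_hull {N : ℕ} {ω : Fin N → ℝ} {A : Set (Fin N → ℝ)}
    (h : IsPositiveCone ω A) : IsPositiveCone ω (PointedCone.hull ℝ A : Set (Fin N → ℝ)) := by
  intro v hv
  induction hv using Submodule.span_induction with
  | mem x hx => exact h x hx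
  | zero => simp
  | add x y _ _ hx hy => simpa [mul_add, Finset.sum_add_distrib] using add_nonneg hx hy
  | smul a x _ hx =>
    have : ∑ j, ω j * (a • x) j = (a : ℝ) * ∑ j, ω j * x j := by
      rw [Finset.mul_sum]
      exact Finset.sum_congr rfl fun j _ => by
        change ω j * ((a : ℝ) * x j) = _
        ring
    rw [this]
    exact mul_nonneg a.2 hx

theorem InPositiveCone.union {N : ℕ} {ω : Fin N → ℝ} {E F : Set (Fin N → ℚ)}
    (hE : InPositiveCone ω E) (hF : InPositiveCone ω F) : InPositiveCone ω (E ∪ F) := by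
  obtain ⟨γ, _, ⟨V, hV, rfl⟩, pV, hE⟩ := hE
  obtain ⟨δ, _, ⟨W, hW, rfl⟩, pW, hF⟩ := hF
  -- translate by the larger of the two vectors and add the difference to the cone
  wlog hle : (∑ j, ω j * (δ j : ℝ)) ≤ ∑ j, ω j * (γ j : ℝ) generalizing γ δ E F V W
  · rw [Set.union_comm]
    exact this δ W hW pW hF γ V hV pV hE (le_of_not_ge hle)
  refine ⟨γ, _, ⟨V ∪ W ∪ {γ - δ}, (hV.union hW).union (Set.finite_singleton _), rfl⟩, ?_, ?_⟩
  · apply isPositiveCone_hull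
    rintro _ ⟨v, (hv | hv) | rfl, rfl⟩
    · exact pV _ (PointedCone.subset_hull ⟨v, hv, rfl⟩)
    · exact pW _ (PointedCone.subset_hull ⟨v, hv, rfl⟩)
    · simp only [Pi.sub_apply, Rat.cast_sub, mul_sub, Finset.sum_sub_distrib]
      linarith
  · rintro α (hα | hα)
    · exact Submodule.span_mono (Set.image_mono (by intro x hx; exact Or.inl (Or.inl hx)))
        (hE α hα)
    · have h1 := Submodule.span_mono (R := {c : ℝ // 0 ≤ c})
        (Set.image_mono (f := fun (v : Fin N → ℚ) (j : Fin N) => (v j : ℝ))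
          (show W ⊆ V ∪ W ∪ {γ - δ} by intro x hx; exact Or.inl (Or.inr hx))) (hF α hα)
      have h2 : (fun j => ((γ j - δ j : ℚ) : ℝ)) ∈ PointedCone.hull ℝ
          ((fun (v : Fin N → ℚ) (j : Fin N) => (v j : ℝ)) '' (V ∪ W ∪ {γ - δ})) :=
        PointedCone.subset_hull ⟨γ - δ, Or.inr rfl, rfl⟩
      have h3 := Submodule.add_mem _ h2 h1
      have h4 : (fun j => ((γ j + α j : ℚ) : ℝ)) =
          (fun j => ((γ j - δ j : ℚ) : ℝ)) + fun j => ((δ j + α j : ℚ) : ℝ) := by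
        ext j
        simp only [Pi.add_apply]
        push_cast
        ring
      rw [h4]
      exact h3

open Pointwise in
theorem InPositiveCone.add {N : ℕ} {ω : Fin N → ℝ} {E F : Set (Fin N → ℚ)}
    (hE : InPositiveCone ω E) (hF : InPositiveCone ω F) : InPositiveCone ω (E + F) := by
  obtain ⟨γ, _, ⟨V, hV, rfl⟩, pV, hE⟩ := hE
  obtain ⟨δ, _, ⟨W, hW, rfl⟩, pW, hF⟩ := hF
  refine ⟨γ + δ, _, ⟨V ∪ W, hV.union hW, rfl⟩, ?_, ?_⟩
  · apply isPositiveCone_hull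
    rintro _ ⟨v, hv | hv, rfl⟩
    · exact pV _ (PointedCone.subset_hull ⟨v, hv, rfl⟩)
    · exact pW _ (PointedCone.subset_hull ⟨v, hv, rfl⟩)
  · rintro _ ⟨α, hα, β, hβ, rfl⟩
    have h1 := Submodule.span_mono (R := {c : ℝ // 0 ≤ c})
      (Set.image_mono (f := fun (v : Fin N → ℚ) (j : Fin N) => (v j : ℝ))
        (show V ⊆ V ∪ W from Set.subset_union_left)) (hE α hα)
    have h2 := Submodule.span_mono (R := {c : ℝ // 0 ≤ c})
      (Set.image_mono (f := fun (v : Fin N → ℚ) (j : Fin N) => (v j : ℝ))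
        (show W ⊆ V ∪ W from Set.subset_union_right)) (hF β hβ)
    have h3 := Submodule.add_mem _ h1 h2
    have h4 : (fun j => (((γ + δ) j + (α + β) j : ℚ) : ℝ)) =
        (fun j => ((γ j + α j : ℚ) : ℝ)) + fun j => ((δ j + β j : ℚ) : ℝ) := by
      ext j
      simp only [Pi.add_apply]
      push_cast
      ring
    exact h4 ▸ h3

section Field

variable {N : ℕ} (ω : Fin N → ℝ) (hω : LinearIndependent ℚ ω) (K : Type*) [Field K]

instance : IsOrderedCancelAddMonoid (Expo ω hω) := inferInstance

instance : CommRing (HahnSeries (Expo ω hω) K) := HahnSeries.instCommRing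

instance : Algebra K (HahnSeries (Expo ω hω) K) := HahnSeries.instAlgebra

/-- The set of exponents `ℰ(φ) ⊆ ℚ^N` of a series. -/
def exponents {K : Type*} [Field K] {ω : Fin N → ℝ} {hω : LinearIndependent ℚ ω}
    (φ : HahnSeries (Expo ω hω) K) : Set (Fin N → ℚ) :=
  {α | φ.coeff (toExpo ω hω α) ≠ 0}

open Pointwise in
/-- The field `S_ω` of `ω`-positive Puiseux series, as a subalgebra of the Hahn series with
exponents in `ℚ^N` ordered by `ω`. (A set of exponents contained in a lattice and in a translate
of an `ω`-positive rational cone is automatically well ordered, so that working inside the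
Hahn series is no restriction; the operations are the usual ones of formal series.) -/
def PuiseuxField : Subalgebra K (HahnSeries (Expo ω hω) K) where
  carrier := {φ | InLattice (exponents φ) ∧ InPositiveCone ω (exponents φ)}
  mul_mem' {φ ψ} hφ hψ := by
    have h : exponents (φ * ψ) ⊆ exponents φ + exponents ψ := by
      intro α hα
      obtain ⟨a, ha, b, hb, hab⟩ := HahnSeries.support_mul_subset
        (show toExpo ω hω α ∈ (φ * ψ).support from hα)
      exact ⟨(toExpo ω hω).symm a, ha, (toExpo ω hω).symm b, hb, (toExpo ω hω).injective hab⟩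
    exact ⟨(hφ.1.add hψ.1).mono h, (hφ.2.add hψ.2).mono h⟩
  add_mem' {φ ψ} hφ hψ := by
    have h : exponents (φ + ψ) ⊆ exponents φ ∪ exponents ψ := fun α hα =>
      HahnSeries.support_add_subset φ ψ (show toExpo ω hω α ∈ (φ + ψ).support from hα)
    exact ⟨(hφ.1.union hψ.1).mono h, (hφ.2.union hψ.2).mono h⟩
  algebraMap_mem' c := by
    have h : exponents (algebraMap K (HahnSeries (Expo ω hω) K) c) ⊆ {0} := fun α hα =>
      (toExpo ω hω).injective (HahnSeries.eq_of_mem_support_single (r := c) hα)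
    exact ⟨(inLattice_singleton 0).mono h, (inPositiveCone_singleton ω 0).mono h⟩

/-- The monomial `c x^α` as an element of `S_ω`. -/
def sMonomial (α : Fin N → ℚ) (c : K) : PuiseuxField ω hω K :=
  ⟨HahnSeries.single (toExpo ω hω α) c, by
    have h : exponents (HahnSeries.single (toExpo ω hω α) c) ⊆ {α} := fun β hβ =>
      (toExpo ω hω).injective (HahnSeries.eq_of_mem_support_single (r := c) hβ)
    exact ⟨(inLattice_singleton α).mono h, (inPositiveCone_singleton ω α).mono h⟩⟩

end Field

/-! ### The rings `𝕂[x*, y] ⊂ S_ω[y]` and `N`-admissible ideals -/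

/-- The ring `𝕂[x*]` of Laurent polynomials in `x_1, …, x_N`. -/
abbrev Laurent (N : ℕ) (K : Type*) [Field K] : Type _ := AddMonoidAlgebra K (Fin N → ℤ)

/-- The ring `𝕂[x*, y] = 𝕂[x*][y_1, …, y_M]`. -/
abbrev LaurentPoly (N M : ℕ) (K : Type*) [Field K] : Type _ := MvPolynomial (Fin M) (Laurent N K)

section Rings

variable {N M : ℕ} {K : Type*} [Field K]

/-- The Laurent monomial `c x^α`. -/
def xMonomial (α : Fin N → ℤ) (c : K) : Laurent N K := AddMonoidAlgebra.single α c

/-- The natural inclusion `𝕂[x, y] → 𝕂[x*, y]`; the variables `x_j` and `y_i` of `𝕂[x, y]`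
are indexed by `Sum.inl j` and `Sum.inr i`. -/
def inclPoly (N M : ℕ) (K : Type*) [Field K] :
    MvPolynomial (Fin N ⊕ Fin M) K →ₐ[K] LaurentPoly N M K :=
  MvPolynomial.aeval
    (Sum.elim (fun j => MvPolynomial.C (xMonomial (Pi.single j 1) 1)) MvPolynomial.X)

/-- An ideal `J ⊆ 𝕂[x, y]` is `N`-admissible when the projection `V(J) → 𝕂^N`,
`(x, y) ↦ x`, is dominant (its image is Zariski dense) and of finite generic fibre
(the fibres over a nonempty open set `p ≠ 0` are finite). -/
def IsAdmissiblePoly (J : Ideal (MvPolynomial (Fin N ⊕ Fin M) K)) : Prop :=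
  MvPolynomial.zeroLocus K (MvPolynomial.vanishingIdeal K
      ((fun v : Fin N ⊕ Fin M → K => v ∘ Sum.inl) '' MvPolynomial.zeroLocus K J)) = Set.univ ∧
    ∃ p : MvPolynomial (Fin N) K, p ≠ 0 ∧ ∀ a : Fin N → K, MvPolynomial.eval a p ≠ 0 →
      {v ∈ MvPolynomial.zeroLocus K J | v ∘ Sum.inl = a}.Finite

/-- An ideal `I ⊆ 𝕂[x*, y]` is `N`-admissible when `I ∩ 𝕂[x, y]` is. -/
def IsAdmissible (I : Ideal (LaurentPoly N M K)) : Prop :=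
  IsAdmissiblePoly (I.comap (inclPoly N M K))

variable (ω : Fin N → ℝ) (hω : LinearIndependent ℚ ω)

/-- The natural inclusion `𝕂[x*] → S_ω`, `x^α ↦ x^α`. -/
def laurentToPuiseux : Laurent N K →ₐ[K] PuiseuxField ω hω K :=
  AddMonoidAlgebra.lift K (PuiseuxField ω hω K) (Fin N → ℤ)
    { toFun := fun α => sMonomial ω hω K (fun j => ((Multiplicative.toAdd α) j : ℚ)) 1
      map_one' := by
        apply Subtype.ext
        change HahnSeries.single (toExpo ω hω fun j => (((0 : Fin N → ℤ) j : ℤ) : ℚ)) (1 : K) = 1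
        have : (fun j => (((0 : Fin N → ℤ) j : ℤ) : ℚ)) = 0 := by ext j; simp
        rw [this, map_zero]
        rfl
      map_mul' := fun α β => by
        apply Subtype.ext
        change HahnSeries.single (toExpo ω hω fun j =>
            ((Multiplicative.toAdd α + Multiplicative.toAdd β) j : ℚ)) (1 : K) =
          HahnSeries.single _ 1 * HahnSeries.single _ 1
        rw [HahnSeries.single_mul_single, mul_one, ← map_add (toExpo ω hω)]
        have h : (fun j => ((Multiplicative.toAdd α + Multiplicative.toAdd β) j : ℚ)) =
            (fun j => ((Multiplicative.toAdd α) j : ℚ)) + fun j => ((Multiplicative.toAdd β) j : ℚ) := by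
          ext j
          simp
        rw [h] }

/-- The extension `I^e ⊆ S_ω[y]` of an ideal `I ⊆ 𝕂[x*, y]`. -/
def extendedIdeal (I : Ideal (LaurentPoly N M K)) :
    Ideal (MvPolynomial (Fin M) (PuiseuxField ω hω K)) :=
  I.map (MvPolynomial.map (laurentToPuiseux (K := K) ω hω).toRingHom)

/-- The set of common zeros in `S_ω^M` of an ideal of `S_ω[y]`. -/
def zeros (J : Ideal (MvPolynomial (Fin M) (PuiseuxField ω hω K))) :
    Set (Fin M → PuiseuxField ω hω K) :=
  {φ | ∀ f ∈ J, MvPolynomial.eval φ f = 0}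

end Rings

/-! ### Fractional power series and `ω`-solutions -/

/-- Fractional power series `∑_{α ∈ ℚ^N} c_α x^α` with arbitrary coefficients `c_α ∈ 𝕂`. -/
abbrev FracSeries (N : ℕ) (K : Type*) : Type _ := (Fin N → ℚ) → K

/-- The `M`-tuple `φ` of fractional power series is an `ω`-solution of `I ⊆ 𝕂[x*, y]`: its
entries belong to `S_ω`, and it is a zero of the extended ideal `I^e`. -/
def IsOmegaSolution {N M : ℕ} {K : Type*} [Field K] (ω : Fin N → ℝ)
    (hω : LinearIndependent ℚ ω) (I : Ideal (LaurentPoly N M K)) (φ : Fin M → FracSeries N K) :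
    Prop :=
  ∃ ψ ∈ zeros ω hω (extendedIdeal ω hω I),
    ∀ i α, (ψ i : HahnSeries (Expo ω hω) K).coeff (toExpo ω hω α) = φ i α

/-! ### Initial ideals in `𝕂[x*, y]` and the tropical variety -/

section Initial

variable {N M : ℕ} {K : Type*} [Field K] (ω : Fin N → ℝ) (η : Fin M → WithTop ℝ)

/-- The weight `ω · α + η · β` of `x^α y^β`, with `∞ · 0 = 0`. -/
def weight (α : Fin N → ℤ) (β : Fin M →₀ ℕ) : WithTop ℝ :=
  ((∑ j, ω j * (α j : ℝ) : ℝ) : WithTop ℝ) + ∑ i, β i • η i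

/-- The `(ω, η)`-order of `f`: the least weight of a term of `f`, and `∞` for `f = 0`. -/
def polyOrder (f : LaurentPoly N M K) : WithTop ℝ :=
  f.support.inf fun β => (MvPolynomial.coeff β f).coeff.support.inf fun α => weight ω η α β

open Classical in
/-- The `(ω, η)`-initial part of `f`: the sum of its terms of least weight, and `0` if the
order of `f` is `∞`. -/
def initialPart (f : LaurentPoly N M K) : LaurentPoly N M K :=
  if polyOrder ω η f = ⊤ then 0 else
    ∑ β ∈ f.support,
      ∑ α ∈ (MvPolynomial.coeff β f).coeff.support with weight ω η α β = polyOrder ω η f,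
        MvPolynomial.monomial β (xMonomial α ((MvPolynomial.coeff β f).coeff α))

/-- The `(ω, η)`-initial ideal of `I`. -/
def initialIdeal (I : Ideal (LaurentPoly N M K)) : Ideal (LaurentPoly N M K) :=
  Ideal.span ({g | ∃ f ∈ I, g = initialPart ω η f} ∪ {g | ∃ i, η i = ⊤ ∧ g = MvPolynomial.X i})

/-- The tropical variety of `I`: the pairs `(ω, η)` for which the initial ideal contains no
monomial `c x^α y^β`, `c ≠ 0`, in the variables `x` and `y_i` with `η_i ≠ ∞`. -/
def tropicalVariety (I : Ideal (LaurentPoly N M K)) :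
    Set ((Fin N → ℝ) × (Fin M → WithTop ℝ)) :=
  {p | ∀ (c : K) (α : Fin N → ℤ) (β : Fin M →₀ ℕ), c ≠ 0 → (∀ i, p.2 i = ⊤ → β i = 0) →
    MvPolynomial.monomial β (xMonomial α c) ∉ initialIdeal p.1 p.2 I}

/-- Evaluation of Laurent polynomials at `x = (1, …, 1)`. -/
def evalOne (N : ℕ) (K : Type*) [Field K] : Laurent N K →ₐ[K] K :=
  AddMonoidAlgebra.lift K K (Fin N → ℤ) 1

end Initial

/-! ### `ω`-sets, `ω`-sequences and the series they define -/

/-- An `ω`-set `{η, Γ, c}`. In the product `ω · Γᵀ` we use `ω_j · ∞ = ∞`; the coordinates of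
a rationally independent `ω` are never zero. -/
structure OmegaSet {N : ℕ} (ω : Fin N → ℝ) (M : ℕ) (K : Type*) [Field K] where
  η : Fin M → WithTop ℝ
  Γ : Matrix (Fin M) (Fin N) (WithTop ℚ)
  c : Fin M → K
  dot_eq : ∀ i, ∑ j, (Γ i j).map (fun q : ℚ => ω j * (q : ℝ)) = η i
  row_top : ∀ i, η i = ⊤ → ∀ j, Γ i j = ⊤
  coeff_ne_zero_iff : ∀ i, c i ≠ 0 ↔ η i ≠ ⊤

namespace OmegaSet

variable {N M : ℕ} {K : Type*} [Field K] {ω : Fin N → ℝ} (D : OmegaSet ω M K)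

/-- The exponent `Γ_{i,*} ∈ ℚ^N` of the `i`-th monomial. The entries `∞` are replaced by the
irrelevant value `0`: they occur only in rows with `c_i = 0`. -/
def expo (i : Fin M) : Fin N → ℚ := fun j => (D.Γ i j).untopD 0

/-- `dΓ`: the least common multiple of the denominators of the (finite) entries of `Γ`. -/
def d : ℕ := Finset.univ.lcm fun p : Fin M × Fin N => (D.expo p.1 p.2).den

/-- The integer `dΓ · Γ_{i,j}`. -/
def intExpo (i : Fin M) (j : Fin N) : ℤ := ((D.d : ℚ) * D.expo i j).num

theorem intExpo_cast (i : Fin M) (j : Fin N) : (D.intExpo i j : ℚ) = (D.d : ℚ) * D.expo i j := by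
  obtain ⟨m, hm⟩ : (D.expo i j).den ∣ D.d :=
    Finset.dvd_lcm (f := fun p : Fin M × Fin N => (D.expo p.1 p.2).den) (Finset.mem_univ (i, j))
  have h : (D.d : ℚ) * D.expo i j = ((m * (D.expo i j).num : ℤ) : ℚ) := by
    rw [hm]
    push_cast
    rw [mul_comm ((D.expo i j).den : ℚ), mul_assoc, Rat.den_mul_eq_num]
  rw [intExpo, h, Rat.num_intCast]

/-- The entries of the `M`-tuple of monomials `𝔐_D(x^{rI})`, where `𝔐_D(x) = x^Γ c` (entrywise
product), as fractional power series. -/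
def tuple (r : ℚ) (i : Fin M) : FracSeries N K := Pi.single (r • D.expo i) (D.c i)

/-- The substitution `f ↦ f(x^{dI}, y + 𝔐_D(x^{dI}))` of `𝕂[x*, y]`, where `d = dΓ`. -/
def subst : LaurentPoly N M K →+* LaurentPoly N M K :=
  MvPolynomial.eval₂Hom
    (MvPolynomial.C.comp
      (AddMonoidAlgebra.mapDomainRingHom K (nsmulAddMonoidHom (α := Fin N → ℤ) D.d)))
    (fun i => MvPolynomial.X i + MvPolynomial.C (xMonomial (D.intExpo i) (D.c i)))

/-- The ideal `I_D`, generated by the `f(x^{dI}, y + 𝔐_D(x^{dI}))` with `f ∈ I`. -/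
def transform (I : Ideal (LaurentPoly N M K)) : Ideal (LaurentPoly N M K) :=
  Ideal.span {g | ∃ f ∈ I, g = D.subst f}

/-- `D` is a starting `ω`-set for `I`. -/
def IsStarting (I : Ideal (LaurentPoly N M K)) : Prop :=
  (ω, D.η) ∈ tropicalVariety I ∧
    ∀ f ∈ initialIdeal ω D.η I, MvPolynomial.eval₂ (evalOne N K : Laurent N K →+* K) D.c f = 0

end OmegaSet

section Sequences

variable {N M : ℕ} {K : Type*} [Field K] {ω : Fin N → ℝ}

/-- The ideals `I^{(0)} = I` and `I^{(n+1)} = (I^{(n)})_{D^{(n)}}`. -/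
def idealSeq (I : Ideal (LaurentPoly N M K)) (S : ℕ → OmegaSet ω M K) :
    ℕ → Ideal (LaurentPoly N M K)
  | 0 => I
  | n + 1 => (S n).transform (idealSeq I S n)

/-- `S = {D^{(n)}}` is an infinite `ω`-sequence for `I`. -/
def IsOmegaSequence (I : Ideal (LaurentPoly N M K)) (S : ℕ → OmegaSet ω M K) : Prop :=
  (∀ n, (S n).IsStarting (idealSeq I S n)) ∧
    ∀ n i, (S (n + 1)).η i ≠ ⊤ → (S n).d • (S n).η i < (S (n + 1)).η i

/-- `r^{(n)} = 1 / ∏_{j < n} dΓ^{(j)}`. -/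
def ramification (S : ℕ → OmegaSet ω M K) (n : ℕ) : ℚ :=
  1 / ∏ j ∈ Finset.range n, ((S j).d : ℚ)

/-- The `n`-th summand `𝔐_{D^{(n)}}(x^{r^{(n)} I})` of `ser(S)`. -/
def serTerm (S : ℕ → OmegaSet ω M K) (n : ℕ) : Fin M → FracSeries N K :=
  (S n).tuple (ramification S n)

/-- The `M`-tuple of series `ser(S) = ∑_n 𝔐_{D^{(n)}}(x^{r^{(n)} I})`, summed coefficientwise
(meaningful when every exponent occurs in only finitely many summands). -/
def ser (S : ℕ → OmegaSet ω M K) (i : Fin M) : FracSeries N K :=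
  fun α => ∑ᶠ n, serTerm S n i α

end Sequences

end OmegaPuiseux

end

/-!
Everything takes place in the field of Hahn series with exponents in `ℚ^N`, ordered by `ω`. In the
variables before ramification, the `n`-th transform of `f ∈ I` is `f(x, y + φ_n)`, where `φ_n` is
the `n`-th partial sum of `ser(S)` (`toHahn_polySeq`). As `ω · α` determines `α`, the hypothesis
that the initial parts vanish at `(1, c)` says that the value of `f(x, y + φ_n)` at the next
monomials has order greater than the weighted order of `f(x, y + φ_n)`
(`mvInitialVanishes_toHahn`). The exponents of the summands strictly increase in every coordinate
until the coordinate terminates, which gives the finiteness assertion.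

Because the order on `ℚ^N` has dense values, increasing exponents need not tend to infinity, and
this is where admissibility enters. By Chevalley's theorem the ideal contains a nonzero polynomial
in each `y_i` alone (`exists_univariate_mem`). For a polynomial `p` in one variable whose initial
forms vanish along a series, one may pass to derivatives until the initial forms of the derivative
no longer vanish, which uses characteristic zero. From some stage on the initial form of `p` is
then linear in `y`, and all further exponents lie in a translate of a monoid generated by finitely
many exponents of nonnegative weight (`exists_closure_of_initialVanishes`). Such a monoid lies in
a lattice and in an `ω`-positive cone, so the entries of `ser(S)` belong to `S_ω` (`serHahn_mem`),
and it has finitely many elements of bounded weight, so the orders of the summands tend to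
infinity.

For `f ∈ I`, the value of `f` at `ser(S)` is therefore approximated by the values at the partial
sums, and the vanishing of the initial forms excludes every finite order for it
(`eval_serHahn_eq_zero`).
-/

noncomputable section

namespace OmegaPuiseux

/-! ### Elimination for admissible ideals -/

open MvPolynomial in
/-- If `J` contains no nonzero polynomial in the variables `ρ s`, then the projection of the zero
locus of `J` to these coordinates contains a nonempty open set. This is Chevalley's theorem for the
spectra, read on closed points by means of the Nullstellensatz. -/
theorem exists_ne_zero_forall_exists_mem_zeroLocus {K : Type*} [Field K] [IsAlgClosed K]
    {σ τ : Type*} [Finite σ] [Finite τ] (ρ : σ → τ) (J : Ideal (MvPolynomial τ K))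
    (hJ : ∀ q : MvPolynomial σ K, rename ρ q ∈ J → q = 0) :
    ∃ g : MvPolynomial σ K, g ≠ 0 ∧
      ∀ b : σ → K, eval b g ≠ 0 → ∃ v ∈ zeroLocus K J, v ∘ ρ = b := by
  let f : MvPolynomial σ K →+* MvPolynomial τ K ⧸ J :=
    (Ideal.Quotient.mk J).comp (rename ρ : MvPolynomial σ K →ₐ[K] MvPolynomial τ K).toRingHom
  have hf : f.FinitePresentation := by
    rw [← RingHom.FinitePresentation.of_finiteType]
    have h1 : (f.comp (C : K →+* MvPolynomial σ K)).FiniteType := by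
      have : f.comp (C : K →+* MvPolynomial σ K) = algebraMap K (MvPolynomial τ K ⧸ J) := by
        ext x
        simp only [f, RingHom.comp_apply, AlgHom.toRingHom_eq_coe, RingHom.coe_coe, rename_C]
        rfl
      rw [this]
      exact RingHom.finiteType_algebraMap.2 inferInstance
    exact RingHom.FiniteType.of_comp_finiteType h1
  obtain ⟨T, hT⟩ := PrimeSpectrum.exists_constructibleSetData_iff.2
    (PrimeSpectrum.isConstructible_range_comap hf)
  have hker : RingHom.ker f = ⊥ := by
    rw [eq_bot_iff]
    intro q hq
    exact hJ q (Ideal.Quotient.eq_zero_iff_mem.1 hq)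
  -- the generic point lies in the image
  obtain ⟨P, hP⟩ : ∃ P, PrimeSpectrum.comap f P = ⟨⊥, Ideal.isPrime_bot⟩ := by
    obtain ⟨P, hP, _, h⟩ := Ideal.exists_comap_eq_of_mem_minimalPrimes f (I := ⊥) ⊥ (by
      have : Ideal.comap f ⊥ = ⊥ := hker
      rw [this]
      exact ⟨⟨Ideal.isPrime_bot, le_rfl⟩, fun _ _ _ => bot_le⟩)
    exact ⟨⟨P, hP⟩, PrimeSpectrum.ext h⟩
  have hgen : (⟨⊥, Ideal.isPrime_bot⟩ : PrimeSpectrum (MvPolynomial σ K)) ∈ T.toSet := by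
    rw [hT]; exact ⟨P, hP⟩
  obtain ⟨D, hD, hDmem⟩ := Set.mem_iUnion₂.1 hgen
  have hg0 : ∀ j, D.g j = 0 := fun j => by simpa using hDmem.1 ⟨j, rfl⟩
  refine ⟨D.f, fun h0 => hDmem.2 (by simp [h0]), fun b hb => ?_⟩
  have hmem : (pointToPoint b : PrimeSpectrum (MvPolynomial σ K)) ∈ T.toSet := by
    refine Set.mem_iUnion₂.2 ⟨D, hD, ?_, ?_⟩
    · rintro _ ⟨j, rfl⟩
      rw [hg0]
      exact Ideal.zero_mem _
    · intro h
      have : D.f ∈ (vanishingIdeal K {b} : Ideal (MvPolynomial σ K)) := by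
        simpa [pointToPoint] using h
      exact hb (by simpa [coe_aeval_eq_eval] using this)
  rw [hT] at hmem
  obtain ⟨Q, hQ⟩ := hmem
  have hQ' : Q.asIdeal.comap f = vanishingIdeal K {b} := congrArg PrimeSpectrum.asIdeal hQ
  obtain ⟨m, hm, hQm⟩ := Ideal.exists_le_maximal (Q.asIdeal.comap (Ideal.Quotient.mk J))
    (Ideal.IsPrime.comap _).ne_top
  obtain ⟨v, rfl⟩ := eq_vanishingIdeal_singleton_of_isMaximal K hm
  refine ⟨v, fun p hp => ?_, funext fun s => ?_⟩
  · refine (mem_vanishingIdeal_singleton_iff v p).1 (hQm ?_)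
    rw [Ideal.mem_comap, Ideal.Quotient.eq_zero_iff_mem.2 hp]
    exact Ideal.zero_mem _
  · have h1 : (X s - C (b s) : MvPolynomial σ K) ∈ vanishingIdeal K {b} := by simp
    rw [← hQ'] at h1
    have h2 := (mem_vanishingIdeal_singleton_iff v _).1 (hQm (show rename ρ (X s - C (b s)) ∈
      Q.asIdeal.comap (Ideal.Quotient.mk J) from h1))
    simpa [sub_eq_zero] using h2

open MvPolynomial in
/-- For an `N`-admissible ideal and each `i` there is a polynomial relation between `x` and `y_i`:
otherwise the projection of the zero locus to the coordinates `(x, y_i)` would contain an open set,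
and the generic fibres over `𝕂^N` would be infinite. -/
theorem exists_elimination {K : Type*} [Field K] [IsAlgClosed K]
    {N M : ℕ} (J : Ideal (MvPolynomial (Fin N ⊕ Fin M) K)) (hJ : IsAdmissiblePoly J) (i : Fin M) :
    ∃ q : MvPolynomial (Option (Fin N)) K, q ≠ 0 ∧
      rename (fun s : Option (Fin N) => s.elim (Sum.inr i) Sum.inl) q ∈ J := by
  classical
  by_contra! hcon
  obtain ⟨-, p, hp, hfin⟩ := hJ
  obtain ⟨g, hg, hpt⟩ := exists_ne_zero_forall_exists_mem_zeroLocus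
    (fun s : Option (Fin N) => s.elim (Sum.inr i : Fin N ⊕ Fin M) Sum.inl) J
    (fun q hq => by by_contra h; exact hcon q h hq)
  have hpg : rename some p * g ≠ 0 :=
    mul_ne_zero (fun h => hp (rename_injective _ (Option.some_injective _) (by simpa using h))) hg
  obtain ⟨b, hb⟩ : ∃ b, eval b (rename some p * g) ≠ 0 := by
    by_contra! h
    exact hpg (MvPolynomial.funext (by simpa using h))
  rw [map_mul, eval_rename] at hb
  have hb1 := left_ne_zero_of_mul hb
  have hb2 := right_ne_zero_of_mul hb
  -- the restriction of `g` to the line `x = a`, `y_i = t`, where `a` is the `x`-part of `b`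
  let G : Polynomial K := aeval (fun s : Option (Fin N) =>
    s.elim Polynomial.X fun j => Polynomial.C (b (some j))) g
  have hG : ∀ t, G.eval t = eval (fun s : Option (Fin N) => s.elim t fun j => b (some j)) g := by
    intro t
    have : (Polynomial.aeval t).comp (aeval (fun s : Option (Fin N) =>
      s.elim Polynomial.X fun j => Polynomial.C (b (some j)))) =
      (aeval (fun s : Option (Fin N) => s.elim t fun j => b (some j)) :
        MvPolynomial (Option (Fin N)) K →ₐ[K] K) := by
      ext s
      cases s <;> simp
    have h2 := DFunLike.congr_fun this g
    simpa [coe_aeval_eq_eval, Polynomial.coe_aeval_eq_eval, G] using h2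
  have hG0 : G ≠ 0 := by
    intro h
    apply hb2
    have hb' : b = fun s : Option (Fin N) => s.elim (b none) fun j => b (some j) := by
      ext s
      cases s <;> rfl
    rw [hb', ← hG, h, Polynomial.eval_zero]
  have hfinite := ((hfin (b ∘ some) hb1).image fun v => v (Sum.inr i)).union
    (G.roots.toFinset.finite_toSet)
  refine Set.infinite_univ (hfinite.subset fun t _ => ?_)
  by_cases ht : G.eval t = 0
  · exact Or.inr (by simp [hG0, ht])
  · left
    rw [hG] at ht
    obtain ⟨v, hv, hvb⟩ := hpt _ ht
    refine ⟨v, ⟨hv, ?_⟩, ?_⟩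
    · ext j
      exact congrFun hvb (some j)
    · exact congrFun hvb none

section

variable {N M : ℕ} {K : Type*} [Field K]

open MvPolynomial in
/-- The inclusion `𝕂[x] → 𝕂[x*]`. -/
def polyToLaurent (N : ℕ) (K : Type*) [Field K] : MvPolynomial (Fin N) K →ₐ[K] Laurent N K :=
  aeval fun j => xMonomial (Pi.single j 1) 1

open MvPolynomial in
theorem polyToLaurent_monomial (m : Fin N →₀ ℕ) (c : K) :
    polyToLaurent N K (monomial m c) = xMonomial (fun j => (m j : ℤ)) c := by
  have h : ∀ s : Finset (Fin N), ∏ j ∈ s, (xMonomial (Pi.single j 1) 1 : Laurent N K) ^ m j =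
      xMonomial (∑ j ∈ s, m j • Pi.single j 1) 1 := by
    intro s
    classical
    induction s using Finset.induction_on with
    | empty => rfl
    | insert j s hj ih =>
      rw [Finset.prod_insert hj, Finset.sum_insert hj, ih, xMonomial, xMonomial, xMonomial,
        AddMonoidAlgebra.single_pow, AddMonoidAlgebra.single_mul_single]
      simp
  rw [polyToLaurent, aeval_monomial, Finsupp.prod_fintype _ _ (by simp), h]
  rw [← Algebra.smul_def, xMonomial, xMonomial, AddMonoidAlgebra.smul_single]
  congr 1
  · ext j
    simp [Finset.sum_apply, Pi.single_apply]
  · simp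

open MvPolynomial in
theorem polyToLaurent_injective : Function.Injective (polyToLaurent N K) := by
  have h : ∀ (q : MvPolynomial (Fin N) K) (m : Fin N →₀ ℕ),
      (polyToLaurent N K q).coeff (fun j => (m j : ℤ)) = q.coeff m := by
    intro q m
    induction q using MvPolynomial.induction_on' with
    | monomial u a =>
      classical
      rw [polyToLaurent_monomial, xMonomial, AddMonoidAlgebra.coeff_single, Finsupp.single_apply,
        coeff_monomial]
      refine if_congr ⟨fun h => ?_, fun h => by rw [h]⟩ rfl rfl
      ext j
      exact_mod_cast congrFun h j
    | add p q hp hq => rw [map_add, coeff_add, ← hp, ← hq]; rfl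
  intro p q hpq
  ext m
  rw [← h p m, ← h q m, hpq]

/-- An `N`-admissible ideal contains, for each `i`, a nonzero polynomial in `y_i` alone. -/
theorem exists_univariate_mem [IsAlgClosed K] {I : Ideal (LaurentPoly N M K)}
    (hI : IsAdmissible I) (i : Fin M) :
    ∃ q : Polynomial (Laurent N K), q ≠ 0 ∧ q.toMvPolynomial i ∈ I := by
  obtain ⟨Q, hQ, hQI⟩ := exists_elimination _ hI i
  refine ⟨(MvPolynomial.optionEquivLeft K (Fin N) Q).map (polyToLaurent N K).toRingHom, ?_, ?_⟩
  · rw [Ne, Polynomial.map_eq_zero_iff polyToLaurent_injective]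
    simpa using hQ
  · rw [Ideal.mem_comap] at hQI
    convert hQI using 1
    have : ((Polynomial.toMvPolynomial (R := Laurent N K) i).toRingHom.comp
        (Polynomial.mapRingHom (polyToLaurent N K).toRingHom)).comp
          (MvPolynomial.optionEquivLeft K (Fin N)).toRingHom =
        (inclPoly N M K).toRingHom.comp (MvPolynomial.rename
          (fun s : Option (Fin N) => s.elim (Sum.inr i) Sum.inl)).toRingHom := by
      refine MvPolynomial.ringHom_ext (fun c => ?_) (fun s => ?_)
      · simp [polyToLaurent, inclPoly]
      · cases s <;> simp [polyToLaurent, inclPoly]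
    exact DFunLike.congr_fun this Q

end

/-! ### The Newton–Puiseux theorem over Hahn series -/

section Hahn

variable {Γ : Type*} {K : Type*} [Field K]

theorem le_orderTop_sum [LinearOrder Γ] {ι : Type*} {s : Finset ι} {f : ι → HahnSeries Γ K} {e : Γ}
    (h : ∀ i ∈ s, (e : WithTop Γ) ≤ (f i).orderTop) :
    (e : WithTop Γ) ≤ (∑ i ∈ s, f i).orderTop := by
  rw [HahnSeries.le_orderTop_iff_forall]
  intro j hj
  rw [HahnSeries.coeff_sum]
  exact Finset.sum_eq_zero fun i hi => HahnSeries.le_orderTop_iff_forall.1 (h i hi) j hj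

/-- The partial sums of a series `∑ c_n x^{a_n}`. -/
def partialSum [LinearOrder Γ] (a : ℕ → Γ) (c : ℕ → K) (n : ℕ) : HahnSeries Γ K :=
  ∑ j ∈ Finset.range n, HahnSeries.single (a j) (c j)

theorem partialSum_succ [LinearOrder Γ] (a : ℕ → Γ) (c : ℕ → K) (n : ℕ) :
    partialSum a c (n + 1) = partialSum a c n + HahnSeries.single (a n) (c n) :=
  Finset.sum_range_succ _ _

/-- The support of `h` is contained in `b + A`. -/
def SupportIn [AddCommGroup Γ] [LinearOrder Γ] (A : AddSubmonoid Γ) (h : HahnSeries Γ K)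
    (b : Γ) : Prop :=
  ∀ δ ∈ h.support, δ - b ∈ A

theorem SupportIn.sum [AddCommGroup Γ] [LinearOrder Γ] {A : AddSubmonoid Γ} {ι : Type*}
    {s : Finset ι} {f : ι → HahnSeries Γ K} {b : Γ} (h : ∀ i ∈ s, SupportIn A (f i) b) :
    SupportIn A (∑ i ∈ s, f i) b := by
  intro δ hδ
  rw [HahnSeries.mem_support, HahnSeries.coeff_sum] at hδ
  obtain ⟨i, hi, hne⟩ := Finset.exists_ne_zero_of_sum_ne_zero hδ
  exact h i hi δ hne

variable [AddCommGroup Γ] [LinearOrder Γ] [IsOrderedAddMonoid Γ]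

theorem le_orderTop_mul {x y : HahnSeries Γ K} {e e' : Γ} (hx : (e : WithTop Γ) ≤ x.orderTop)
    (hy : (e' : WithTop Γ) ≤ y.orderTop) : ((e + e' : Γ) : WithTop Γ) ≤ (x * y).orderTop := by
  rw [WithTop.coe_add]
  exact (add_le_add hx hy).trans HahnSeries.orderTop_add_le_mul

/-- All terms `p_k y^k` have order at least `e` when `y` is given the weight `a`. -/
def WeightGE (p : Polynomial (HahnSeries Γ K)) (a e : Γ) : Prop :=
  ∀ k, ((e - k • a : Γ) : WithTop Γ) ≤ (p.coeff k).orderTop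

theorem WeightGE.mul {p q : Polynomial (HahnSeries Γ K)} {a e e' : Γ} (hp : WeightGE p a e)
    (hq : WeightGE q a e') : WeightGE (p * q) a (e + e') := by
  intro k
  rw [Polynomial.coeff_mul]
  refine le_orderTop_sum fun x hx => ?_
  rw [Finset.HasAntidiagonal.mem_antidiagonal] at hx
  convert le_orderTop_mul (hp x.1) (hq x.2) using 2
  rw [← hx, add_smul]
  abel

theorem weightGE_C {h : HahnSeries Γ K} {a e : Γ} (hh : (e : WithTop Γ) ≤ h.orderTop) :
    WeightGE (Polynomial.C h) a e := by
  intro k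
  rw [Polynomial.coeff_C]
  split_ifs with hk
  · simpa [hk] using hh
  · simp

theorem weightGE_X_add_C {s : HahnSeries Γ K} {a : Γ} (hs : (a : WithTop Γ) ≤ s.orderTop) :
    WeightGE (Polynomial.X + Polynomial.C s) a a := by
  rintro (_ | _ | k)
  · simpa using hs
  · simp only [zero_add, one_smul, sub_self, Polynomial.coeff_add, Polynomial.coeff_X_one,
      Polynomial.coeff_C_succ, add_zero, HahnSeries.orderTop_one]
    exact le_rfl
  · simp [Polynomial.coeff_X]

theorem WeightGE.pow {p : Polynomial (HahnSeries Γ K)} {a e : Γ} (hp : WeightGE p a e) (n : ℕ) :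
    WeightGE (p ^ n) a (n • e) := by
  induction n with
  | zero =>
    rw [pow_zero, zero_smul, ← Polynomial.C_1]
    exact weightGE_C (by simp)
  | succ n ih =>
    rw [pow_succ, succ_nsmul]
    exact ih.mul hp

/-- The weighted order does not decrease under a translation of `y` by a series of order at least
the weight of `y`. -/
theorem WeightGE.taylor {p : Polynomial (HahnSeries Γ K)} {a e : Γ} (hp : WeightGE p a e)
    {s : HahnSeries Γ K} (hs : (a : WithTop Γ) ≤ s.orderTop) :
    WeightGE (Polynomial.taylor s p) a e := by
  intro k
  conv_rhs => rw [p.as_sum_support, map_sum, Polynomial.finsetSum_coeff]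
  refine le_orderTop_sum fun j _ => ?_
  rw [Polynomial.taylor_monomial]
  have h := (weightGE_C (a := a) (hp j)).mul ((weightGE_X_add_C hs).pow j)
  rw [sub_add_cancel] at h
  exact h k

theorem coeff_eval_single (p : Polynomial (HahnSeries Γ K)) (a e : Γ) (c : K) :
    (p.eval (HahnSeries.single a c)).coeff e =
      ∑ k ∈ Finset.range (p.natDegree + 1), (p.coeff k).coeff (e - k • a) * c ^ k := by
  rw [Polynomial.eval_eq_sum_range, HahnSeries.coeff_sum]
  refine Finset.sum_congr rfl fun k _ => ?_
  rw [HahnSeries.single_pow]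
  conv_lhs => rw [← sub_add_cancel e (k • a)]
  rw [HahnSeries.coeff_mul_single_add]

/-- The initial form of `p` with respect to the weight `a` of `y` vanishes at `c`: the value
`p(c x^a)` has order greater than the weighted order of `p`. -/
def InitialVanishes (p : Polynomial (HahnSeries Γ K)) (a : Γ) (c : K) : Prop :=
  ∀ e, WeightGE p a e → (p.eval (HahnSeries.single a c)).coeff e = 0

/-- The initial form of `p` with respect to the weight `a` of `y` is a nonzero constant,
of order `e`. -/
def ConstantDominates (p : Polynomial (HahnSeries Γ K)) (a e : Γ) : Prop :=
  (p.coeff 0).orderTop = e ∧ ∀ k, k ≠ 0 → ((e - k • a : Γ) : WithTop Γ) < (p.coeff k).orderTop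

/-- Once an initial form does not vanish at the leading coefficient of the translation, the
constant term dominates for all larger weights. -/
theorem constantDominates_taylor {p : Polynomial (HahnSeries Γ K)} {a a' e : Γ} {c : K}
    (hp : WeightGE p a e) (h : (p.eval (HahnSeries.single a c)).coeff e ≠ 0) (ha : a < a') :
    ConstantDominates (Polynomial.taylor (HahnSeries.single a c) p) a' e := by
  have hW := hp.taylor (HahnSeries.orderTop_single_le (a := a) (r := c))
  refine ⟨le_antisymm ?_ (by simpa using hW 0), fun k hk => lt_of_lt_of_le ?_ (hW k)⟩
  · rw [Polynomial.taylor_coeff_zero]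
    exact HahnSeries.orderTop_le_of_coeff_ne_zero h
  · exact WithTop.coe_lt_coe.2 (sub_lt_sub_left (nsmul_lt_nsmul_right hk ha) e)

theorem ConstantDominates.weightGE {p : Polynomial (HahnSeries Γ K)} {a e : Γ}
    (h : ConstantDominates p a e) : WeightGE p a e := by
  intro k
  rcases eq_or_ne k 0 with rfl | hk
  · simpa using h.1.ge
  · exact (h.2 k hk).le

theorem ConstantDominates.taylor {p : Polynomial (HahnSeries Γ K)} {a a' e : Γ} {c : K}
    (h : ConstantDominates p a e) (ha : a < a') :
    ConstantDominates (Polynomial.taylor (HahnSeries.single a c) p) a' e := by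
  refine constantDominates_taylor h.weightGE ?_ ha
  rw [coeff_eval_single, Finset.sum_eq_single 0]
  · simpa using HahnSeries.coeff_orderTop_ne h.1
  · intro k _ hk
    rw [HahnSeries.coeff_eq_zero_of_lt_orderTop (h.2 k hk), zero_mul]
  · simp

theorem taylor_partialSum_succ (p : Polynomial (HahnSeries Γ K)) (a : ℕ → Γ) (c : ℕ → K) (n : ℕ) :
    Polynomial.taylor (partialSum a c (n + 1)) p =
      Polynomial.taylor (HahnSeries.single (a n) (c n))
        (Polynomial.taylor (partialSum a c n) p) := by
  rw [Polynomial.taylor_taylor, partialSum_succ, add_comm]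

/-- If the initial form fails to vanish at one stage, then from the next stage on the constant term
dominates, and its order `e` no longer changes. -/
theorem exists_forall_constantDominates {p : Polynomial (HahnSeries Γ K)} {a : ℕ → Γ} {c : ℕ → K}
    (ha : StrictMono a)
    (h : ¬ ∀ n, InitialVanishes (Polynomial.taylor (partialSum a c n) p) (a n) (c n)) :
    ∃ n₀ e, ∀ n, n₀ ≤ n → ConstantDominates (Polynomial.taylor (partialSum a c n) p) (a n) e := by
  simp only [InitialVanishes, not_forall] at h
  obtain ⟨m, e, hW, hne⟩ := h
  refine ⟨m + 1, e, fun n hn => ?_⟩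
  induction n, hn using Nat.le_induction with
  | base =>
    rw [taylor_partialSum_succ]
    exact constantDominates_taylor hW hne (ha (Nat.lt_succ_self m))
  | succ n _ ih =>
    rw [taylor_partialSum_succ]
    exact ih.taylor (ha (Nat.lt_succ_self n))

/-- The Hahn series with finite support. -/
def finiteSupport (Γ : Type*) [AddCommGroup Γ] [LinearOrder Γ] [IsOrderedAddMonoid Γ]
    (K : Type*) [Field K] : Subring (HahnSeries Γ K) where
  carrier := {h | h.support.Finite}
  mul_mem' {x y} hx hy := (hx.add hy).subset HahnSeries.support_mul_subset
  add_mem' {x y} hx hy := (hx.union hy).subset (HahnSeries.support_add_subset x y)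
  zero_mem' := by simp
  one_mem' := (Set.finite_singleton 0).subset HahnSeries.support_single_subset
  neg_mem' {x} hx := by simpa only [Set.mem_ofPred_eq, HahnSeries.support_neg] using hx

theorem single_mem_finiteSupport (a : Γ) (c : K) : HahnSeries.single a c ∈ finiteSupport Γ K :=
  (Set.finite_singleton a).subset HahnSeries.support_single_subset

theorem taylor_coeff_mem {R : Type*} [CommRing R] (A : Subring R) {p : Polynomial R} {s : R}
    (hp : ∀ k, p.coeff k ∈ A) (hs : s ∈ A) (k : ℕ) : (Polynomial.taylor s p).coeff k ∈ A := by
  rw [Polynomial.taylor_coeff, Polynomial.eval_eq_sum_range]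
  refine A.sum_mem fun j _ => A.mul_mem ?_ (A.pow_mem hs j)
  rw [Polynomial.hasseDeriv_coeff]
  exact A.mul_mem (natCast_mem A _) (hp _)

theorem SupportIn.mul {A : AddSubmonoid Γ} {x y : HahnSeries Γ K} {b b' : Γ}
    (hx : SupportIn A x b) (hy : SupportIn A y b') : SupportIn A (x * y) (b + b') := by
  intro δ hδ
  obtain ⟨u, hu, v, hv, rfl⟩ := HahnSeries.support_mul_subset hδ
  convert A.add_mem (hx u hu) (hy v hv) using 1
  change u + v - (b + b') = _
  abel

theorem SupportIn.pow {A : AddSubmonoid Γ} {x : HahnSeries Γ K} {b : Γ}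
    (hx : SupportIn A x b) (n : ℕ) : SupportIn A (x ^ n) (n • b) := by
  induction n with
  | zero =>
    intro δ hδ
    rw [pow_zero] at hδ
    rw [HahnSeries.support_single_subset hδ]
    simp
  | succ n ih =>
    rw [pow_succ, succ_nsmul]
    exact ih.mul hx

/-- When the initial form vanishes at `c ≠ 0` and is linear in `y`, the constant term
has a term of the order prescribed by the linear term. -/
theorem coeff_zero_ne_zero_of_linear {p : Polynomial (HahnSeries Γ K)} {a γ : Γ} {c : K}
    (hc : c ≠ 0) (h1 : (p.coeff 1).orderTop = γ)
    (h2 : ∀ k, 2 ≤ k → ((γ + a - k • a : Γ) : WithTop Γ) < (p.coeff k).orderTop)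
    (hV : InitialVanishes p a c) :
    WeightGE p a (γ + a) ∧ (p.coeff 0).coeff (γ + a) ≠ 0 := by
  have hW : ∀ e ≤ γ + a, (e : WithTop Γ) ≤ (p.coeff 0).orderTop → WeightGE p a e := by
    intro e he h0 k
    have hk : ((e - k • a : Γ) : WithTop Γ) ≤ ((γ + a - k • a : Γ) : WithTop Γ) :=
      WithTop.coe_le_coe.2 (sub_le_sub_right he _)
    rcases Nat.lt_or_ge k 2 with hk2 | hk2
    · interval_cases k
      · simpa using h0
      · refine hk.trans ?_
        rw [h1]
        simp
    · exact hk.trans (h2 k hk2).le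
  have h0 : ((γ + a : Γ) : WithTop Γ) ≤ (p.coeff 0).orderTop := by
    by_contra! hlt
    obtain ⟨e, he⟩ := WithTop.ne_top_iff_exists.1 hlt.ne_top
    have hlt' : e < γ + a := by rw [← he] at hlt; exact WithTop.coe_lt_coe.1 hlt
    have hv := hV e (hW e hlt'.le he.le)
    rw [coeff_eval_single, Finset.sum_eq_single 0] at hv
    · exact HahnSeries.coeff_orderTop_ne he.symm (by simpa using hv)
    · intro k _ hk
      rw [HahnSeries.coeff_eq_zero_of_lt_orderTop, zero_mul]
      have hlt2 : ((e - k • a : Γ) : WithTop Γ) < ((γ + a - k • a : Γ) : WithTop Γ) :=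
        WithTop.coe_lt_coe.2 (sub_lt_sub_right hlt' _)
      rcases Nat.lt_or_ge k 2 with hk2 | hk2
      · obtain rfl : k = 1 := by omega
        rw [h1]
        simpa using hlt2
      · exact hlt2.trans (h2 k hk2)
    · simp
  refine ⟨hW _ le_rfl h0, fun h => ?_⟩
  have hv := hV _ (hW _ le_rfl h0)
  have hd : 1 ≤ p.natDegree := Polynomial.le_natDegree_of_ne_zero fun h => by simp [h] at h1
  rw [coeff_eval_single, Finset.sum_eq_single 1] at hv
  · have := HahnSeries.coeff_orderTop_ne h1
    simp [this, hc] at hv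
  · intro k _ hk
    rcases Nat.lt_or_ge k 2 with hk2 | hk2
    · obtain rfl : k = 0 := by omega
      simp [h]
    · rw [HahnSeries.coeff_eq_zero_of_lt_orderTop (h2 k hk2), zero_mul]
  · intro h
    exact absurd (Finset.mem_range.2 (by omega)) h

theorem orderTop_natCast_mul [CharZero K] {n : ℕ} (hn : n ≠ 0) (x : HahnSeries Γ K) :
    ((n : HahnSeries Γ K) * x).orderTop = x.orderTop := by
  have : (n : HahnSeries Γ K) = HahnSeries.single 0 (n : K) := by
    rw [← HahnSeries.C_apply, map_natCast]
  rw [HahnSeries.orderTop_mul, this, HahnSeries.orderTop_single (Nat.cast_ne_zero.2 hn)]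
  simp

/-- The simple case of the Newton–Puiseux theorem. If the initial forms of `p` vanish along the
sequence but those of its derivative do not, then from some stage `n₀` on the initial form of `p` is
linear in `y`. Each further exponent is read off from the constant term of the translate of `p`,
so that it lies in `a_{n₀}` plus the monoid generated by the finitely many exponents of the
translate at stage `n₀`, normalized by its linear term. -/
theorem exists_closure_of_linear [CharZero K] {p : Polynomial (HahnSeries Γ K)} {a : ℕ → Γ}
    {c : ℕ → K} (ha : StrictMono a) (hc : ∀ n, c n ≠ 0)
    (hfin : ∀ k, p.coeff k ∈ finiteSupport Γ K)
    (hV : ∀ n, InitialVanishes (Polynomial.taylor (partialSum a c n) p) (a n) (c n))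
    (hder : ¬ ∀ n, InitialVanishes
      (Polynomial.taylor (partialSum a c n) (Polynomial.derivative p)) (a n) (c n)) :
    ∃ n₀, ∃ E : Set Γ, E.Finite ∧ (∀ e ∈ E, 0 ≤ e) ∧
      ∀ n, n₀ ≤ n → a n - a n₀ ∈ AddSubmonoid.closure E := by
  obtain ⟨m, γ, hdom⟩ := exists_forall_constantDominates ha hder
  have hcoeff : ∀ n k, (Polynomial.taylor (partialSum a c n) (Polynomial.derivative p)).coeff k =
      ((k + 1 : ℕ) : HahnSeries Γ K) * (Polynomial.taylor (partialSum a c n) p).coeff (k + 1) := by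
    intro n k
    have : Polynomial.taylor (partialSum a c n) (Polynomial.derivative p) =
        Polynomial.derivative (Polynomial.taylor (partialSum a c n) p) := by
      simp [Polynomial.taylor_apply, Polynomial.derivative_comp]
    rw [this, Polynomial.coeff_derivative, mul_comm]
    push_cast
    rfl
  have hlin : ∀ n, m ≤ n → WeightGE (Polynomial.taylor (partialSum a c n) p) (a n) (γ + a n) ∧
      ((Polynomial.taylor (partialSum a c n) p).coeff 0).coeff (γ + a n) ≠ 0 := by
    intro n hn
    refine coeff_zero_ne_zero_of_linear (hc n) ?_ ?_ (hV n)
    · have := (hdom n hn).1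
      rwa [hcoeff, orderTop_natCast_mul (by omega)] at this
    · intro k hk
      obtain ⟨k, rfl⟩ := Nat.exists_eq_add_of_le hk
      have := (hdom n hn).2 (k + 1) (by omega)
      rw [hcoeff, orderTop_natCast_mul (by omega)] at this
      rw [show 2 + k = k + 1 + 1 by ring, succ_nsmul _ (k + 1)]
      convert this using 2
      abel
  -- the exponents of `g` relative to the common order `γ + a_m` of its initial form
  set g := Polynomial.taylor (partialSum a c m) p with hg
  have hgfin : ∀ k, g.coeff k ∈ finiteSupport Γ K := taylor_coeff_mem _ hfin
    (Subring.sum_mem _ fun j _ => single_mem_finiteSupport _ _)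
  let E : Set Γ := ⋃ k ∈ Finset.range (g.natDegree + 1),
    (fun δ => δ - (γ + a m - k • a m)) '' (g.coeff k).support
  refine ⟨m, E, ?_, ?_, ?_⟩
  · exact Set.Finite.biUnion (Finset.finite_toSet _) fun k _ => Set.Finite.image _ (hgfin k)
  · rintro e he
    simp only [E, Set.mem_iUnion] at he
    obtain ⟨k, -, δ, hδ, rfl⟩ := he
    refine sub_nonneg.2 (WithTop.coe_le_coe.1 ?_)
    exact ((hlin m le_rfl).1 k).trans (HahnSeries.orderTop_le_of_coeff_ne_zero hδ)
  · intro n hn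
    induction n using Nat.strong_induction_on with
    | _ n ih =>
      have hψ : SupportIn (AddSubmonoid.closure E)
          (∑ j ∈ Finset.Ico m n, HahnSeries.single (a j) (c j)) (a m) := by
        refine SupportIn.sum fun j hj δ hδ => ?_
        rw [HahnSeries.support_single_subset hδ]
        exact ih j (Finset.mem_Ico.1 hj).2 (Finset.mem_Ico.1 hj).1
      have heval : (Polynomial.taylor (partialSum a c n) p).coeff 0 =
          g.eval (∑ j ∈ Finset.Ico m n, HahnSeries.single (a j) (c j)) := by
        rw [Polynomial.taylor_coeff_zero, hg, Polynomial.taylor_eval, partialSum, partialSum,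
          ← Finset.sum_range_add_sum_Ico _ hn, add_comm]
      have hsupp := (hlin n hn).2
      rw [heval, Polynomial.eval_eq_sum_range] at hsupp
      have := SupportIn.sum (A := AddSubmonoid.closure E) (b := γ + a m) (fun k hk => ?_) _ hsupp
      · convert this using 1
        abel
      · have h1 : SupportIn (AddSubmonoid.closure E) (g.coeff k) (γ + a m - k • a m) :=
          fun δ hδ => AddSubmonoid.subset_closure
            (Set.mem_biUnion (x := k) (by exact_mod_cast hk) ⟨δ, hδ, rfl⟩)
        have h2 := h1.mul (hψ.pow k)
        rwa [sub_add_cancel] at h2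

/-- The Newton–Puiseux theorem. If the initial forms of a nonzero polynomial `p`, with coefficients
of finite support, vanish along the series `∑ c_n x^{a_n}`, then the exponents of this series lie,
up to finitely many, in a translate of a finitely generated monoid of nonnegative exponents.
By induction on the degree: either the derivative of `p` has the same property, or the simple case
applies. -/
theorem exists_closure_of_initialVanishes [CharZero K] {p : Polynomial (HahnSeries Γ K)}
    (hp : p ≠ 0) {a : ℕ → Γ} {c : ℕ → K} (ha : StrictMono a) (hc : ∀ n, c n ≠ 0)
    (hfin : ∀ k, p.coeff k ∈ finiteSupport Γ K)
    (hV : ∀ n, InitialVanishes (Polynomial.taylor (partialSum a c n) p) (a n) (c n)) :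
    ∃ n₀, ∃ E : Set Γ, E.Finite ∧ (∀ e ∈ E, 0 ≤ e) ∧
      ∀ n, n₀ ≤ n → a n - a n₀ ∈ AddSubmonoid.closure E := by
  induction hd : p.natDegree using Nat.strong_induction_on generalizing p with
  | _ d ih =>
    by_cases hder : ∀ n, InitialVanishes
      (Polynomial.taylor (partialSum a c n) (Polynomial.derivative p)) (a n) (c n)
    -- the value of a nonzero constant has exactly its weighted order
    · have hd0 : p.natDegree ≠ 0 := by
        intro h0
        obtain ⟨h, rfl⟩ := Polynomial.natDegree_eq_zero.1 h0
        have hh : h ≠ 0 := by simpa using hp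
        have h1 := hV 0 h.order (by
          rw [Polynomial.taylor_C]
          exact weightGE_C (HahnSeries.order_eq_orderTop_of_ne_zero hh).le)
        rw [Polynomial.taylor_C, Polynomial.eval_C, HahnSeries.coeff_order_eq_zero] at h1
        exact hh h1
      refine ih _ ?_ ?_ ?_ hder rfl
      · rw [← hd]
        exact Polynomial.natDegree_derivative_lt hd0
      · intro h
        have : CharZero (HahnSeries Γ K) :=
          charZero_of_injective_algebraMap (algebraMap K (HahnSeries Γ K)).injective
        exact hd0 (Polynomial.derivative_eq_zero.1 h)
      · intro k
        rw [Polynomial.coeff_derivative]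
        exact Subring.mul_mem _ (hfin _) (by exact_mod_cast natCast_mem (finiteSupport Γ K) (k + 1))
    · exact exists_closure_of_linear ha hc hfin hV hder

end Hahn

/-! ### Transforms of polynomials as translations over Hahn series -/

section Bridge

variable {N M : ℕ} {K : Type*} [Field K] (ω : Fin N → ℝ) (hω : LinearIndependent ℚ ω)

theorem dot_toExpo (v : Fin N → ℚ) : dot ω hω (toExpo ω hω v) = ∑ j, ω j * (v j : ℝ) := rfl

/-- The exponents `r α`, for `α ∈ ℤ^N`. -/
def scaledExpo (r : ℚ) : (Fin N → ℤ) →+ Expo ω hω :=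
  (toExpo ω hω).toAddMonoidHom.comp
    { toFun := fun α j => r * (α j : ℚ)
      map_zero' := by ext j; simp
      map_add' := fun α β => by ext j; simp [mul_add] }

theorem scaledExpo_injective {r : ℚ} (hr : r ≠ 0) : Function.Injective (scaledExpo ω hω r) := by
  intro α β h
  have h' := (toExpo ω hω).injective h
  ext j
  have := congrFun h' j
  simpa [hr] using this

/-- The substitution `f ↦ f(x^{rI})`, from Laurent polynomials to Hahn series. -/
def dilate (r : ℚ) : Laurent N K →ₐ[K] HahnSeries (Expo ω hω) K :=
  AddMonoidAlgebra.lift K (HahnSeries (Expo ω hω) K) (Fin N → ℤ)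
    { toFun := fun α => HahnSeries.single (scaledExpo ω hω r α.toAdd) 1
      map_one' := by
        rw [toAdd_one, map_zero]
        rfl
      map_mul' := fun α β => by
        rw [HahnSeries.single_mul_single, mul_one, toAdd_mul, map_add] }

theorem dilate_single (r : ℚ) (α : Fin N → ℤ) (c : K) :
    dilate ω hω r (AddMonoidAlgebra.single α c) = HahnSeries.single (scaledExpo ω hω r α) c := by
  rw [dilate, AddMonoidAlgebra.lift_single]
  change c • HahnSeries.single (scaledExpo ω hω r α) (1 : K) = _
  ext e
  by_cases h : e = scaledExpo ω hω r α
  · subst h; simp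
  · simp [HahnSeries.coeff_single_of_ne h]

theorem dilate_apply (r : ℚ) (f : Laurent N K) :
    dilate ω hω r f = ∑ α ∈ f.coeff.support,
      HahnSeries.single (scaledExpo ω hω r α) (f.coeff α) := by
  conv_lhs => rw [← AddMonoidAlgebra.sum_coeff_single f, Finsupp.sum, map_sum]
  exact Finset.sum_congr rfl fun α _ => dilate_single ω hω r α _

theorem coeff_dilate {r : ℚ} (hr : r ≠ 0) (f : Laurent N K) (α : Fin N → ℤ) :
    (dilate ω hω r f).coeff (scaledExpo ω hω r α) = f.coeff α := by
  rw [dilate_apply, HahnSeries.coeff_sum, Finset.sum_eq_single α]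
  · exact HahnSeries.coeff_single_same _ _
  · intro β _ hβ
    exact HahnSeries.coeff_single_of_ne fun h => hβ (scaledExpo_injective ω hω hr h).symm
  · intro h
    rw [HahnSeries.coeff_single_same]
    simpa using h

theorem dilate_injective {r : ℚ} (hr : r ≠ 0) :
    Function.Injective (dilate (K := K) ω hω r) := by
  intro f g h
  ext α
  rw [← coeff_dilate ω hω hr, ← coeff_dilate ω hω hr, h]

theorem dilate_mem_finiteSupport (r : ℚ) (f : Laurent N K) :
    dilate ω hω r f ∈ finiteSupport (Expo ω hω) K := by
  rw [dilate_apply]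
  exact Subring.sum_mem _ fun α _ => single_mem_finiteSupport _ _

theorem coe_laurentToPuiseux (f : Laurent N K) :
    (laurentToPuiseux ω hω f : HahnSeries (Expo ω hω) K) = dilate ω hω 1 f := by
  have h : (PuiseuxField ω hω K).val.comp (laurentToPuiseux ω hω) = dilate ω hω 1 := by
    refine AddMonoidAlgebra.algHom_ext ?_ (Subsingleton.elim _ _)
    intro α
    rw [dilate_single, AlgHom.comp_apply, laurentToPuiseux, AddMonoidAlgebra.lift_single, one_smul]
    change HahnSeries.single (toExpo ω hω _) (1 : K) = HahnSeries.single (toExpo ω hω _) 1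
    congr 2
    ext j
    simp
  exact DFunLike.congr_fun h f

/-- The substitution `f ↦ f(x^{rI}, y)`, with values in the polynomials over Hahn series. -/
def toHahn (r : ℚ) : LaurentPoly N M K →+* MvPolynomial (Fin M) (HahnSeries (Expo ω hω) K) :=
  MvPolynomial.map (dilate (K := K) ω hω r).toRingHom

/-- The translation `F ↦ F(y + ψ)`. -/
def translate {ι R : Type*} [CommRing R] (ψ : ι → R) : MvPolynomial ι R →+* MvPolynomial ι R :=
  MvPolynomial.eval₂Hom MvPolynomial.C fun i => MvPolynomial.X i + MvPolynomial.C (ψ i)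

theorem translate_translate {ι R : Type*} [CommRing R] (ψ χ : ι → R) (F : MvPolynomial ι R) :
    translate ψ (translate χ F) = translate (ψ + χ) F := by
  have : (translate ψ).comp (translate χ) = translate (ψ + χ) := by
    refine MvPolynomial.ringHom_ext (fun c => ?_) (fun i => ?_)
    · simp [translate]
    · simp [translate, add_assoc]
  exact DFunLike.congr_fun this F

theorem translate_zero {ι R : Type*} [CommRing R] (F : MvPolynomial ι R) :
    translate 0 F = F := by
  have : translate (0 : ι → R) = RingHom.id _ := by
    refine MvPolynomial.ringHom_ext (fun c => ?_) (fun i => ?_) <;> simp [translate]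
  exact DFunLike.congr_fun this F

theorem eval_translate {ι R : Type*} [CommRing R] (ψ χ : ι → R) (F : MvPolynomial ι R) :
    MvPolynomial.eval χ (translate ψ F) = MvPolynomial.eval (χ + ψ) F := by
  have : (MvPolynomial.eval χ).comp (translate ψ) = MvPolynomial.eval (χ + ψ) := by
    refine MvPolynomial.ringHom_ext (fun c => ?_) (fun i => ?_) <;> simp [translate]
  exact DFunLike.congr_fun this F

theorem OmegaSet.d_pos {ω : Fin N → ℝ} (D : OmegaSet ω M K) : 0 < D.d := by
  refine Nat.pos_of_ne_zero fun h => ?_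
  rw [OmegaSet.d, Finset.lcm_eq_zero_iff] at h
  obtain ⟨p, -, hp⟩ := h
  exact (D.expo p.1 p.2).den_ne_zero hp

variable {ω}

/-- In the variables before ramification, the substitution attached to an `ω`-set is the
translation of `y` by its tuple of monomials. -/
theorem toHahn_subst (D : OmegaSet ω M K) (r : ℚ) (f : LaurentPoly N M K) :
    toHahn ω hω (r / D.d) (D.subst f) =
      translate (fun i => HahnSeries.single (toExpo ω hω (r • D.expo i)) (D.c i))
        (toHahn ω hω r f) := by
  have hd : (D.d : ℚ) ≠ 0 := by exact_mod_cast D.d_pos.ne'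
  have hC : ∀ g : Laurent N K, dilate ω hω (r / D.d) (AddMonoidAlgebra.mapDomainRingHom K
      (nsmulAddMonoidHom (α := Fin N → ℤ) D.d) g) = dilate ω hω r g := by
    intro g
    have : (dilate (K := K) ω hω (r / D.d)).toRingHom.comp (AddMonoidAlgebra.mapDomainRingHom K
        (nsmulAddMonoidHom (α := Fin N → ℤ) D.d)) = (dilate ω hω r).toRingHom := by
      refine AddMonoidAlgebra.ringHom_ext (fun c => ?_) (fun α => ?_)
      · simp [dilate_single]
      · simp only [AlgHom.toRingHom_eq_coe, RingHom.comp_apply, RingHom.coe_coe,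
          AddMonoidAlgebra.mapDomainRingHom_apply, AddMonoidAlgebra.mapDomain_single, dilate_single]
        refine congrArg (HahnSeries.single · _) ?_
        change toExpo ω hω _ = toExpo ω hω _
        congr 1
        ext j
        simp
        field_simp
    exact DFunLike.congr_fun this g
  have : (toHahn ω hω (r / D.d)).comp D.subst =
      (translate (fun i => HahnSeries.single (toExpo ω hω (r • D.expo i)) (D.c i))).comp
        (toHahn ω hω r) := by
    refine MvPolynomial.ringHom_ext (fun g => ?_) (fun i => ?_)
    · simpa [toHahn, translate, OmegaSet.subst] using hC g
    · simp only [toHahn, translate, OmegaSet.subst, RingHom.comp_apply, MvPolynomial.coe_eval₂Hom,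
        MvPolynomial.eval₂_X, map_add, MvPolynomial.map_X, MvPolynomial.map_C]
      congr 2
      rw [xMonomial]
      refine (dilate_single ω hω _ _ _).trans ?_
      refine congrArg (HahnSeries.single · _) ?_
      change toExpo ω hω _ = toExpo ω hω _
      congr 1
      ext j
      simp only [AddMonoidHom.coe_mk, ZeroHom.coe_mk, Pi.smul_apply, smul_eq_mul,
        OmegaSet.intExpo_cast]
      field_simp
  exact DFunLike.congr_fun this f

/-- The successive transforms of `f` along the sequence `S`. -/
def polySeq (S : ℕ → OmegaSet ω M K) (f : LaurentPoly N M K) : ℕ → LaurentPoly N M K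
  | 0 => f
  | n + 1 => (S n).subst (polySeq S f n)

theorem polySeq_mem {I : Ideal (LaurentPoly N M K)} (S : ℕ → OmegaSet ω M K)
    {f : LaurentPoly N M K} (hf : f ∈ I) (n : ℕ) : polySeq S f n ∈ idealSeq I S n := by
  induction n with
  | zero => exact hf
  | succ n ih => exact Ideal.subset_span ⟨_, ih, rfl⟩

/-- The exponent of the `i`-th entry of the `n`-th summand of `ser(S)`. -/
def serExpo (S : ℕ → OmegaSet ω M K) (i : Fin M) (n : ℕ) : Expo ω hω :=
  toExpo ω hω (ramification S n • (S n).expo i)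

/-- The tuple of partial sums of `ser(S)`. -/
def serPartial (S : ℕ → OmegaSet ω M K) (n : ℕ) (i : Fin M) : HahnSeries (Expo ω hω) K :=
  partialSum (serExpo hω S i) (fun n => (S n).c i) n

theorem ramification_succ (S : ℕ → OmegaSet ω M K) (n : ℕ) :
    ramification S (n + 1) = ramification S n / (S n).d := by
  rw [ramification, ramification, Finset.prod_range_succ, div_div]

theorem ramification_pos (S : ℕ → OmegaSet ω M K) (n : ℕ) : 0 < ramification S n :=
  one_div_pos.2 (Finset.prod_pos fun j _ => by exact_mod_cast (S j).d_pos)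

/-- After undoing the ramification, the `n`-th transform of `f` is `f(x, y + φ_n)`, where `φ_n` is
the `n`-th partial sum of `ser(S)`. -/
theorem toHahn_polySeq (S : ℕ → OmegaSet ω M K) (f : LaurentPoly N M K) (n : ℕ) :
    toHahn ω hω (ramification S n) (polySeq S f n) =
      translate (serPartial hω S n) (toHahn ω hω 1 f) := by
  induction n with
  | zero =>
    have : serPartial hω S 0 = 0 := rfl
    rw [this, translate_zero]
    simp [ramification, polySeq]
  | succ n ih =>
    rw [ramification_succ, polySeq, toHahn_subst, ih, translate_translate]
    congr 2
    ext1 i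
    rw [Pi.add_apply, add_comm]
    exact (partialSum_succ _ _ _).symm

end Bridge

/-! ### Initial parts over Hahn series -/

section Initial

variable {N M : ℕ} {K : Type*} [Field K] {ω : Fin N → ℝ} (hω : LinearIndependent ℚ ω)

theorem OmegaSet.η_eq (D : OmegaSet ω M K) {i : Fin M} (hi : D.c i ≠ 0) :
    D.η i = ((∑ j, ω j * (D.expo i j : ℝ) : ℝ) : WithTop ℝ) := by
  have hη := (D.coeff_ne_zero_iff i).1 hi
  have hsum := D.dot_eq i
  rw [← hsum] at hη
  rw [← hsum, WithTop.coe_sum]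
  refine Finset.sum_congr rfl fun j _ => ?_
  have hj : D.Γ i j ≠ ⊤ := by
    intro h
    exact hη (WithTop.sum_eq_top.2 ⟨j, Finset.mem_univ j, by rw [h]; rfl⟩)
  obtain ⟨q, hq⟩ := WithTop.ne_top_iff_exists.1 hj
  simp only [OmegaSet.expo, ← hq]
  rfl

theorem OmegaSet.η_eq_top (D : OmegaSet ω M K) {i : Fin M} (hi : D.c i = 0) : D.η i = ⊤ := by
  by_contra h
  exact (D.coeff_ne_zero_iff i).2 h hi

theorem dot_smul_expo (D : OmegaSet ω M K) (r : ℚ) (i : Fin M) :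
    dot ω hω (toExpo ω hω (r • D.expo i)) = r * ∑ j, ω j * (D.expo i j : ℝ) := by
  rw [dot_toExpo, Finset.mul_sum]
  refine Finset.sum_congr rfl fun j _ => ?_
  simp only [Pi.smul_apply, smul_eq_mul]
  push_cast
  ring

/-- All terms of `F` in the variables `y_i` with `c_i ≠ 0` have order at least `e` when `y_i` is
given the weight `a_i`. -/
def MvWeightGE {ι Γ : Type*} [Fintype ι] [AddCommGroup Γ] [LinearOrder Γ]
    [IsOrderedAddMonoid Γ]
    (F : MvPolynomial ι (HahnSeries Γ K)) (a : ι → Γ) (c : ι → K) (e : Γ) : Prop :=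
  ∀ β : ι →₀ ℕ, (∀ i, c i = 0 → β i = 0) →
    ((e - ∑ i, β i • a i : Γ) : WithTop Γ) ≤ (F.coeff β).orderTop

/-- The initial form of `F` vanishes at `c` when `y_i` has weight `a_i` if `c_i ≠ 0` and
infinite weight otherwise. -/
def MvInitialVanishes {ι Γ : Type*} [Fintype ι] [AddCommGroup Γ] [LinearOrder Γ]
    [IsOrderedAddMonoid Γ]
    (F : MvPolynomial ι (HahnSeries Γ K)) (a : ι → Γ) (c : ι → K) : Prop :=
  ∀ e, MvWeightGE F a c e →
    (MvPolynomial.eval (fun i => HahnSeries.single (a i) (c i)) F).coeff e = 0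

theorem prod_single_pow {ι Γ : Type*} [AddCommGroup Γ] [LinearOrder Γ]
    [IsOrderedAddMonoid Γ] (s : Finset ι) (a : ι → Γ) (c : ι → K) (β : ι → ℕ) :
    ∏ i ∈ s, (HahnSeries.single (a i) (c i)) ^ β i =
      HahnSeries.single (∑ i ∈ s, β i • a i) (∏ i ∈ s, c i ^ β i) := by
  classical
  induction s using Finset.induction_on with
  | empty => rfl
  | insert i s hi ih =>
    rw [Finset.prod_insert hi, Finset.prod_insert hi, Finset.sum_insert hi, ih,
      HahnSeries.single_pow, HahnSeries.single_mul_single]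

/-- On monomials in the `y_i` with `c_i ≠ 0`, the weight is, up to the factor `r`, the order of the
Hahn monomial obtained by substituting `x^r` for `x` and `c x^{rΓ}` for `y`. -/
theorem weight_eq (D : OmegaSet ω M K) {r : ℚ} (hr : r ≠ 0) (α : Fin N → ℤ) (β : Fin M →₀ ℕ)
    (hβ : ∀ i, D.c i = 0 → β i = 0) :
    weight ω D.η α β = ((dot ω hω (scaledExpo ω hω r α +
      ∑ i, β i • toExpo ω hω (r • D.expo i)) / r : ℝ) : WithTop ℝ) := by
  have hr' : (r : ℝ) ≠ 0 := by exact_mod_cast hr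
  have h1 : ∀ i, β i • D.η i = ((β i • ∑ j, ω j * (D.expo i j : ℝ) : ℝ) : WithTop ℝ) := by
    intro i
    by_cases hi : D.c i = 0
    · simp [hβ i hi]
    · rw [D.η_eq hi, WithTop.coe_nsmul]
  have h2 : dot ω hω (scaledExpo ω hω r α) = r * ∑ j, ω j * (α j : ℝ) := by
    change ∑ j, ω j * ((r * (α j : ℚ) : ℚ) : ℝ) = _
    rw [Finset.mul_sum]
    refine Finset.sum_congr rfl fun j _ => ?_
    push_cast
    ring
  rw [weight, Finset.sum_congr rfl fun i _ => h1 i, ← WithTop.coe_sum, ← WithTop.coe_add]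
  congr 1
  rw [map_add, map_sum, h2, eq_div_iff hr', add_mul]
  congr 1
  · exact mul_comm _ _
  · rw [Finset.sum_mul]
    refine Finset.sum_congr rfl fun i _ => ?_
    rw [map_nsmul, dot_smul_expo]
    simp only [nsmul_eq_mul]
    ring

theorem eval_toHahn_single (G : LaurentPoly N M K) (r : ℚ) (a : Fin M → Expo ω hω)
    (c : Fin M → K) :
    MvPolynomial.eval (fun i => HahnSeries.single (a i) (c i)) (toHahn ω hω r G) =
      ∑ β ∈ G.support, ∑ α ∈ (MvPolynomial.coeff β G).coeff.support,
        HahnSeries.single (scaledExpo ω hω r α + ∑ i, β i • a i)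
          ((MvPolynomial.coeff β G).coeff α * ∏ i, c i ^ β i) := by
  rw [toHahn, MvPolynomial.eval_map, MvPolynomial.eval₂_eq']
  refine Finset.sum_congr rfl fun β _ => ?_
  rw [prod_single_pow]
  change dilate ω hω r _ * _ = _
  rw [dilate_apply, Finset.sum_mul]
  exact Finset.sum_congr rfl fun α _ => HahnSeries.single_mul_single

open Classical in
theorem eval₂_initialPart {η : Fin M → WithTop ℝ} {G : LaurentPoly N M K}
    (hG : polyOrder ω η G ≠ ⊤) (c : Fin M → K) :
    MvPolynomial.eval₂ (evalOne N K : Laurent N K →+* K) c (initialPart ω η G) =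
      ∑ β ∈ G.support, ∑ α ∈ (MvPolynomial.coeff β G).coeff.support,
        if weight ω η α β = polyOrder ω η G then
          (MvPolynomial.coeff β G).coeff α * ∏ i, c i ^ β i else 0 := by
  rw [initialPart, if_neg hG, MvPolynomial.eval₂_sum]
  refine Finset.sum_congr rfl fun β _ => ?_
  rw [MvPolynomial.eval₂_sum, Finset.sum_filter]
  refine Finset.sum_congr rfl fun α _ => ?_
  split_ifs
  · rw [MvPolynomial.eval₂_monomial, Finsupp.prod_fintype _ _ (by simp), xMonomial]
    congr 1
    change evalOne N K _ = _
    rw [evalOne, AddMonoidAlgebra.lift_single]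
    simp
  · rfl

theorem exists_weight_eq_polyOrder {η : Fin M → WithTop ℝ} {G : LaurentPoly N M K}
    (hG : polyOrder ω η G ≠ ⊤) :
    ∃ β ∈ G.support, ∃ α ∈ (MvPolynomial.coeff β G).coeff.support,
      weight ω η α β = polyOrder ω η G := by
  have h1 : G.support.Nonempty := by
    rw [Finset.nonempty_iff_ne_empty]
    intro h
    exact hG (by rw [polyOrder, h, Finset.inf_empty])
  obtain ⟨β, hβ, h2⟩ := Finset.exists_mem_eq_inf _ h1
    fun β => (MvPolynomial.coeff β G).coeff.support.inf fun α => weight ω η α β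
  have h3 : (MvPolynomial.coeff β G).coeff.support.Nonempty := by
    rw [Finset.nonempty_iff_ne_empty]
    intro h
    exact hG (by rw [polyOrder, h2, h, Finset.inf_empty])
  obtain ⟨α, hα, h4⟩ := Finset.exists_mem_eq_inf _ h3 fun α => weight ω η α β
  exact ⟨β, hβ, α, hα, by rw [polyOrder, h2, h4]⟩

theorem polyOrder_le_weight {η : Fin M → WithTop ℝ} {G : LaurentPoly N M K} {β : Fin M →₀ ℕ}
    (hβ : β ∈ G.support) {α : Fin N → ℤ} (hα : α ∈ (MvPolynomial.coeff β G).coeff.support) :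
    polyOrder ω η G ≤ weight ω η α β :=
  (Finset.inf_le hβ).trans (Finset.inf_le (f := fun α => weight ω η α β) hα)

/-- The vanishing at `(1, c)` of the initial part of `G` in `𝕂[x*, y]`, translated to Hahn series:
since `ω · α` determines `α`, all terms of least weight of `G` contribute to one and the same
exponent of `G(x^r, c x^{rΓ})`, with total coefficient the value of the initial part at `(1, c)`. -/
theorem mvInitialVanishes_toHahn (D : OmegaSet ω M K) {r : ℚ} (hr : 0 < r)
    {G : LaurentPoly N M K}
    (hG : MvPolynomial.eval₂ (evalOne N K : Laurent N K →+* K) D.c (initialPart ω D.η G) = 0) :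
    MvInitialVanishes (toHahn ω hω r G) (fun i => toExpo ω hω (r • D.expo i)) D.c := by
  classical
  intro e he
  have hr' : (0 : ℝ) < r := by exact_mod_cast hr
  have hprod : ∀ β : Fin M →₀ ℕ, ∏ i, D.c i ^ β i ≠ 0 → ∀ i, D.c i = 0 → β i = 0 := by
    intro β h i hi
    by_contra hβ
    exact h (Finset.prod_eq_zero (Finset.mem_univ i) (by rw [hi, zero_pow hβ]))
  rw [eval_toHahn_single, HahnSeries.coeff_sum]
  simp only [HahnSeries.coeff_sum]
  by_cases htop : polyOrder ω D.η G = ⊤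
  -- every term contains some `y_i` with `c_i = 0`
  · refine Finset.sum_eq_zero fun β hβ => Finset.sum_eq_zero fun α hα => ?_
    have h0 : ∏ i, D.c i ^ β i = 0 := by
      by_contra h
      have := polyOrder_le_weight (ω := ω) (η := D.η) hβ hα
      rw [htop, weight_eq hω D hr.ne' α β (hprod β h), top_le_iff] at this
      exact WithTop.coe_ne_top this
    simp [h0]
  -- the weighted order is attained at a term in the `y_i` with `c_i ≠ 0`
  · have hbound : ((dot ω hω e / r : ℝ) : WithTop ℝ) ≤ polyOrder ω D.η G := by
      obtain ⟨β, hβ, α, hα, h⟩ := exists_weight_eq_polyOrder htop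
      have hβ' : ∀ i, D.c i = 0 → β i = 0 := by
        intro i hi
        by_contra hne
        apply htop
        rw [← h, weight, WithTop.add_eq_top]
        right
        refine WithTop.sum_eq_top.2 ⟨i, Finset.mem_univ i, ?_⟩
        rw [D.η_eq_top hi]
        obtain ⟨k, hk⟩ := Nat.exists_eq_succ_of_ne_zero hne
        rw [hk, succ_nsmul, WithTop.add_top]
      rw [← h, weight_eq hω D hr.ne' α β hβ', WithTop.coe_le_coe]
      refine div_le_div_of_nonneg_right ?_ hr'.le
      rw [← expo_le_iff]
      have h1 := he β hβ'
      have h2 : ((toHahn ω hω r G).coeff β).orderTop ≤ (scaledExpo ω hω r α : Expo ω hω) := by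
        apply HahnSeries.orderTop_le_of_coeff_ne_zero
        rw [toHahn, MvPolynomial.coeff_map]
        change (dilate ω hω r _).coeff _ ≠ 0
        rw [coeff_dilate ω hω hr.ne']
        exact Finsupp.mem_support_iff.1 hα
      exact sub_le_iff_le_add.1 (WithTop.coe_le_coe.1 (h1.trans h2))
    -- the exponent `e` is met either by exactly the terms of least weight or by no term
    have key : ∀ β ∈ G.support, ∀ α ∈ (MvPolynomial.coeff β G).coeff.support,
        (HahnSeries.single (scaledExpo ω hω r α + ∑ i, β i • toExpo ω hω (r • D.expo i))
          ((MvPolynomial.coeff β G).coeff α * ∏ i, D.c i ^ β i)).coeff e =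
        if ((dot ω hω e / r : ℝ) : WithTop ℝ) = polyOrder ω D.η G then
          (if weight ω D.η α β = polyOrder ω D.η G then
            (MvPolynomial.coeff β G).coeff α * ∏ i, D.c i ^ β i else 0) else 0 := by
      intro β hβ α hα
      by_cases h0 : ∏ i, D.c i ^ β i = 0
      · simp [h0]
      have hle := polyOrder_le_weight (ω := ω) (η := D.η) hβ hα
      have hw := weight_eq hω D hr.ne' α β (hprod β h0)
      have hiff : e = scaledExpo ω hω r α + ∑ i, β i • toExpo ω hω (r • D.expo i) ↔
          ((dot ω hω e / r : ℝ) : WithTop ℝ) = polyOrder ω D.η G ∧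
            weight ω D.η α β = polyOrder ω D.η G := by
        refine ⟨fun h => ?_, fun h => ?_⟩
        · rw [← h] at hw
          rw [hw] at hle ⊢
          exact ⟨le_antisymm hbound hle, le_antisymm hbound hle⟩
        · have h1 := h.1.trans h.2.symm
          rw [hw, WithTop.coe_inj, div_left_inj' hr'.ne'] at h1
          exact dot_injective ω hω h1
      rw [← ite_and, HahnSeries.coeff_single]
      by_cases h : e = scaledExpo ω hω r α + ∑ i, β i • toExpo ω hω (r • D.expo i)
      · rw [if_pos h, if_pos (hiff.1 h)]
      · rw [if_neg h, if_neg (mt hiff.2 h)]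
    rw [Finset.sum_congr rfl fun β hβ => Finset.sum_congr rfl (key β hβ)]
    split_ifs with h
    · rw [← eval₂_initialPart htop, hG]
    · simp

/-- A polynomial in `y_i` alone has nonzero coefficients only at the powers of `y_i`. -/
theorem toMvPolynomial_coeff_eq {ι R : Type*} [CommRing R] (p : Polynomial R) (i : ι)
    (β : ι →₀ ℕ) : (p.toMvPolynomial i).coeff β = 0 ∨
      ∃ k, β = Finsupp.single i k ∧ (p.toMvPolynomial i).coeff β = p.coeff k := by
  classical
  by_cases hβ : β = Finsupp.single i (β i)
  · refine Or.inr ⟨β i, hβ, ?_⟩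
    induction p using Polynomial.induction_on' with
    | add p q hp hq => rw [map_add, MvPolynomial.coeff_add, hp, hq, Polynomial.coeff_add]
    | monomial n a =>
      rw [← Polynomial.C_mul_X_pow_eq_monomial, map_mul, map_pow, Polynomial.toMvPolynomial_C,
        Polynomial.toMvPolynomial_X, MvPolynomial.coeff_C_mul, MvPolynomial.coeff_X_pow,
        Polynomial.coeff_C_mul_X_pow]
      by_cases h : β i = n
      · rw [if_pos h, if_pos (by rw [hβ, h]), mul_one]
      · rw [if_neg h, if_neg, mul_zero]
        rintro rfl
        simp at h
  · left
    induction p using Polynomial.induction_on' with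
    | add p q hp hq => rw [map_add, MvPolynomial.coeff_add, hp, hq, add_zero]
    | monomial n a =>
      rw [← Polynomial.C_mul_X_pow_eq_monomial, map_mul, map_pow, Polynomial.toMvPolynomial_C,
        Polynomial.toMvPolynomial_X, MvPolynomial.coeff_C_mul, MvPolynomial.coeff_X_pow,
        if_neg, mul_zero]
      rintro rfl
      simp at hβ

theorem MvInitialVanishes.univariate {ι Γ : Type*} [Fintype ι] [AddCommGroup Γ] [LinearOrder Γ]
    [IsOrderedAddMonoid Γ] {p : Polynomial (HahnSeries Γ K)} {i : ι} {a : ι → Γ} {c : ι → K}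
    (h : MvInitialVanishes (p.toMvPolynomial i) a c) : InitialVanishes p (a i) (c i) := by
  intro e he
  rw [← h e ?_, MvPolynomial.eval_toMvPolynomial]
  intro β _
  rcases toMvPolynomial_coeff_eq p i β with h0 | ⟨k, rfl, hk⟩
  · simp [h0]
  · classical
    rw [hk]
    convert he k using 3
    rw [Finset.sum_eq_single i] <;> simp +contextual [eq_comm]

theorem translate_toMvPolynomial {ι R : Type*} [CommRing R] (p : Polynomial R) (i : ι)
    (ψ : ι → R) :
    translate ψ (p.toMvPolynomial i) = (Polynomial.taylor (ψ i) p).toMvPolynomial i := by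
  have : (translate ψ).comp (Polynomial.toMvPolynomial (R := R) i).toRingHom =
      (Polynomial.toMvPolynomial (R := R) i).toRingHom.comp
        (Polynomial.taylorAlgHom (ψ i)).toRingHom := by
    refine Polynomial.ringHom_ext (fun c => ?_) ?_ <;> simp [translate]
  exact DFunLike.congr_fun this p

theorem toHahn_toMvPolynomial (p : Polynomial (Laurent N K)) (i : Fin M) (r : ℚ) :
    toHahn ω hω r (p.toMvPolynomial i) =
      (p.map (dilate ω hω r).toRingHom).toMvPolynomial i := by
  have : (toHahn ω hω r).comp (Polynomial.toMvPolynomial (R := Laurent N K) i).toRingHom =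
      (Polynomial.toMvPolynomial (R := HahnSeries (Expo ω hω) K) i).toRingHom.comp
        (Polynomial.mapRingHom (dilate ω hω r).toRingHom) := by
    refine Polynomial.ringHom_ext (fun c => ?_) ?_ <;> simp [toHahn]
  exact DFunLike.congr_fun this p

/-- Along an `ω`-sequence, the initial forms of `f(x, y + φ_n)` vanish at `c^{(n)}` for all `f`
in the ideal. -/
theorem IsOmegaSequence.mvInitialVanishes {I : Ideal (LaurentPoly N M K)}
    {S : ℕ → OmegaSet ω M K} (hS : IsOmegaSequence I S) {f : LaurentPoly N M K} (hf : f ∈ I)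
    (n : ℕ) :
    MvInitialVanishes (translate (serPartial hω S n) (toHahn ω hω 1 f))
      (fun i => serExpo hω S i n) (S n).c := by
  rw [← toHahn_polySeq]
  refine mvInitialVanishes_toHahn hω (S n) (ramification_pos S n) ((hS.1 n).2 _ ?_)
  exact Ideal.subset_span (Or.inl ⟨_, polySeq_mem S hf n, rfl⟩)

end Initial

/-! ### Approximation of values and finitely generated monoids of exponents -/

section Approximation

variable {Γ : Type*} {K : Type*} [Field K] {ι : Type*}

theorem exists_le_orderTop [AddCommGroup Γ] [LinearOrder Γ] (h : HahnSeries Γ K) :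
    ∃ e : Γ, (e : WithTop Γ) ≤ h.orderTop := by
  by_cases h0 : h = 0
  · exact ⟨0, by simp [h0]⟩
  · exact ⟨h.order, (HahnSeries.order_eq_orderTop_of_ne_zero h0).le⟩

variable [AddCommGroup Γ] [LinearOrder Γ] [IsOrderedAddMonoid Γ]

/-- The orders of the coefficients of `F(y + ψ)` are bounded below uniformly in `ψ`, as long as
the orders of the entries of `ψ` are. -/
theorem exists_le_orderTop_coeff_translate (F : MvPolynomial ι (HahnSeries Γ K)) (b : ι → Γ) :
    ∃ C : Γ, ∀ ψ : ι → HahnSeries Γ K, (∀ i, (b i : WithTop Γ) ≤ (ψ i).orderTop) →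
      ∀ β, (C : WithTop Γ) ≤ ((translate ψ F).coeff β).orderTop := by
  classical
  induction F using MvPolynomial.induction_on with
  | C h =>
    obtain ⟨e, he⟩ := exists_le_orderTop h
    refine ⟨e, fun ψ _ β => ?_⟩
    have : translate ψ (MvPolynomial.C h) = MvPolynomial.C h := by simp [translate]
    rw [this, MvPolynomial.coeff_C]
    split_ifs
    · exact he
    · simp
  | add F G hF hG =>
    obtain ⟨C, hC⟩ := hF
    obtain ⟨C', hC'⟩ := hG
    refine ⟨min C C', fun ψ hψ β => ?_⟩
    rw [map_add, MvPolynomial.coeff_add, WithTop.coe_min]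
    exact (min_le_min (hC ψ hψ β) (hC' ψ hψ β)).trans HahnSeries.min_orderTop_le_orderTop_add
  | mul_X F i hF =>
    obtain ⟨C, hC⟩ := hF
    refine ⟨min C (b i + C), fun ψ hψ β => ?_⟩
    have : translate ψ (MvPolynomial.X i) = MvPolynomial.X i + MvPolynomial.C (ψ i) := by
      simp [translate]
    rw [map_mul, this, mul_add, MvPolynomial.coeff_add, WithTop.coe_min, MvPolynomial.coeff_mul_X',
      mul_comm _ (MvPolynomial.C (ψ i)), MvPolynomial.coeff_C_mul]
    refine le_trans (min_le_min ?_ (le_orderTop_mul (hψ i) (hC ψ hψ β)))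
      HahnSeries.min_orderTop_le_orderTop_add
    split_ifs
    · exact hC ψ hψ _
    · simp

theorem zero_le_orderTop_prod_pow (s : Finset ι) {t : ι → HahnSeries Γ K}
    (ht : ∀ i, ((0 : Γ) : WithTop Γ) ≤ (t i).orderTop) (β : ι → ℕ) :
    ((0 : Γ) : WithTop Γ) ≤ (∏ i ∈ s, t i ^ β i).orderTop := by
  have hmul : ∀ x y : HahnSeries Γ K, ((0 : Γ) : WithTop Γ) ≤ x.orderTop →
      ((0 : Γ) : WithTop Γ) ≤ y.orderTop → ((0 : Γ) : WithTop Γ) ≤ (x * y).orderTop := by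
    intro x y hx hy
    simpa using le_orderTop_mul hx hy
  have hone : ((0 : Γ) : WithTop Γ) ≤ (1 : HahnSeries Γ K).orderTop := by simp
  refine Finset.prod_induction _ (fun x : HahnSeries Γ K => ((0 : Γ) : WithTop Γ) ≤ x.orderTop)
    hmul hone ?_
  intro i _
  induction β i with
  | zero => simp
  | succ n ih => rw [pow_succ]; exact hmul _ _ ih (ht i)

/-- At arguments of large order a polynomial agrees with its constant term up to a given order. -/
theorem coeff_eval_eq_coeff_zero [Fintype ι] {G : MvPolynomial ι (HahnSeries Γ K)} {C B l : Γ}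
    (hG : ∀ β, (C : WithTop Γ) ≤ (G.coeff β).orderTop) (hB : 0 ≤ B) (hl : l ≤ C + B)
    {t : ι → HahnSeries Γ K} (ht : ∀ i, (B : WithTop Γ) < (t i).orderTop) {e : Γ} (he : e ≤ l) :
    (MvPolynomial.eval t G).coeff e = (G.coeff 0).coeff e := by
  classical
  have ht0 : ∀ i, ((0 : Γ) : WithTop Γ) ≤ (t i).orderTop := fun i =>
    (WithTop.coe_le_coe.2 hB).trans (ht i).le
  rw [MvPolynomial.eval_eq', HahnSeries.coeff_sum, Finset.sum_eq_single 0]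
  · simp
  · intro β _ hβ
    obtain ⟨i, hi⟩ := Finsupp.ne_iff.1 hβ
    obtain ⟨k, hk⟩ := Nat.exists_eq_succ_of_ne_zero hi
    rw [← Finset.mul_prod_erase _ _ (Finset.mem_univ i), hk, pow_succ]
    by_cases hti : t i = 0
    · simp [hti]
    obtain ⟨a, ha⟩ := WithTop.ne_top_iff_exists.1 (HahnSeries.orderTop_ne_top.2 hti)
    have hBa : B < a := by
      have := ht i
      rw [← ha] at this
      exact WithTop.coe_lt_coe.1 this
    have hpow : ((0 : Γ) : WithTop Γ) ≤ (t i ^ k).orderTop := by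
      simpa using zero_le_orderTop_prod_pow {i} ht0 fun _ => k
    have h := le_orderTop_mul (hG β) (le_orderTop_mul (le_orderTop_mul hpow ha.le)
      (zero_le_orderTop_prod_pow (Finset.univ.erase i) ht0 β))
    refine HahnSeries.coeff_eq_zero_of_lt_orderTop (lt_of_lt_of_le (WithTop.coe_lt_coe.2 ?_) h)
    rw [zero_add, add_zero]
    exact (he.trans hl).trans_lt (add_lt_add_right hBa C)
  · intro h
    rw [MvPolynomial.notMem_support_iff.1 h]
    simp

end Approximation

section Monoid

variable {N : ℕ} {ω : Fin N → ℝ} (hω : LinearIndependent ℚ ω)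

theorem expo_lt_iff {α β : Expo ω hω} : α < β ↔ dot ω hω α < dot ω hω β := by
  rw [← not_le, ← not_le, expo_le_iff]

theorem nonneg_of_mem_closure {E : Set (Expo ω hω)} (hE : ∀ e ∈ E, 0 ≤ e) {x : Expo ω hω}
    (hx : x ∈ AddSubmonoid.closure E) : 0 ≤ x := by
  induction hx using AddSubmonoid.closure_induction with
  | mem x h => exact hE x h
  | zero => exact le_rfl
  | add x y _ _ hx hy => exact add_nonneg hx hy

/-- A monoid generated by finitely many exponents of nonnegative weight has only finitely many
elements of bounded weight. -/
theorem finite_closure_le {E : Set (Expo ω hω)} (hfin : E.Finite) (hE : ∀ e ∈ E, 0 ≤ e)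
    (B : Expo ω hω) : {x | x ∈ AddSubmonoid.closure E ∧ x ≤ B}.Finite := by
  induction E, hfin using Set.Finite.induction_on with
  | empty =>
    refine (Set.finite_singleton 0).subset ?_
    rintro x ⟨hx, -⟩
    simpa using hx
  | @insert e E _ _ ih =>
    have hE' : ∀ x ∈ E, 0 ≤ x := fun x hx => hE x (Or.inr hx)
    have he : 0 ≤ e := hE e (Or.inl rfl)
    have hfin := ih hE'
    obtain ⟨k₀, hk₀⟩ : ∃ k₀ : ℕ, ∀ k : ℕ, k • e ≤ B → k • e = 0 ∨ k < k₀ := by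
      rcases he.eq_or_lt with rfl | he
      · exact ⟨0, fun k _ => Or.inl (smul_zero k)⟩
      · have hpos : 0 < dot ω hω e := by
          have := (expo_lt_iff hω).1 he
          rwa [map_zero] at this
        obtain ⟨k₀, hk⟩ := exists_nat_gt (dot ω hω B / dot ω hω e)
        refine ⟨k₀, fun k hk' => Or.inr ?_⟩
        rw [expo_le_iff, map_nsmul, nsmul_eq_mul, ← le_div_iff₀ hpos] at hk'
        exact_mod_cast hk'.trans_lt hk
    refine (hfin.union ((Set.finite_Iio k₀).biUnion fun k _ =>
      hfin.image fun y => k • e + y)).subset ?_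
    rintro x ⟨hx, hxB⟩
    rw [Set.insert_eq, AddSubmonoid.closure_union, AddSubmonoid.mem_sup] at hx
    obtain ⟨u, hu, y, hy, rfl⟩ := hx
    obtain ⟨k, rfl⟩ := AddSubmonoid.mem_closure_singleton.1 hu
    have hy0 := nonneg_of_mem_closure hω hE' hy
    have hk0 : 0 ≤ k • e := nsmul_nonneg he k
    have hyB : y ≤ B := (le_add_of_nonneg_left hk0).trans hxB
    rcases hk₀ k ((le_add_of_nonneg_right hy0).trans hxB) with h | h
    · left
      rw [h, zero_add]
      exact ⟨hy, hyB⟩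
    · right
      exact Set.mem_biUnion (x := k) h ⟨y, ⟨hy, hyB⟩, rfl⟩

theorem inLattice_of_finite {E : Set (Fin N → ℚ)} (hE : E.Finite) : InLattice E := by
  induction E, hE using Set.Finite.induction_on with
  | empty => exact ⟨1, one_pos, fun α h => h.elim⟩
  | insert _ _ ih => exact Set.insert_eq _ _ ▸ (inLattice_singleton _).union ih

theorem inPositiveCone_of_finite {E : Set (Fin N → ℚ)} (hE : E.Finite) :
    InPositiveCone ω E := by
  induction E, hE using Set.Finite.induction_on with
  | empty => exact (inPositiveCone_singleton ω 0).mono (Set.empty_subset _)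
  | insert _ _ ih => exact Set.insert_eq _ _ ▸ (inPositiveCone_singleton ω _).union ih

theorem inLattice_closure {E : Set (Expo ω hω)} (hE : E.Finite) :
    InLattice {v | toExpo ω hω v ∈ AddSubmonoid.closure E} := by
  obtain ⟨k, hk, h⟩ := inLattice_of_finite (hE.image (toExpo ω hω).symm)
  refine ⟨k, hk, fun v hv => ?_⟩
  have : ∀ x ∈ AddSubmonoid.closure E, ∀ j, ∃ z : ℤ, (k : ℚ) * (toExpo ω hω).symm x j = z := by
    intro x hx
    induction hx using AddSubmonoid.closure_induction with
    | mem x hx => exact h _ ⟨x, hx, rfl⟩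
    | zero => exact fun j => ⟨0, by simp⟩
    | add x y _ _ hx hy =>
      intro j
      obtain ⟨z, hz⟩ := hx j
      obtain ⟨w, hw⟩ := hy j
      exact ⟨z + w, by rw [map_add, Pi.add_apply, mul_add, hz, hw]; push_cast; rfl⟩
  simpa using this _ hv

theorem inPositiveCone_closure {E : Set (Expo ω hω)} (hE : E.Finite) (hpos : ∀ e ∈ E, 0 ≤ e) :
    InPositiveCone ω {v | toExpo ω hω v ∈ AddSubmonoid.closure E} := by
  refine ⟨0, _, ⟨_, hE.image (toExpo ω hω).symm, rfl⟩, isPositiveCone_hull ?_, fun v hv => ?_⟩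
  · rintro _ ⟨_, ⟨e, he, rfl⟩, rfl⟩
    have := (expo_le_iff ω hω).1 (hpos e he)
    rwa [map_zero] at this
  · have : ∀ x ∈ AddSubmonoid.closure E, (fun j => (((toExpo ω hω).symm x j : ℚ) : ℝ)) ∈
        PointedCone.hull ℝ ((fun (v : Fin N → ℚ) (j : Fin N) => (v j : ℝ)) ''
          ((toExpo ω hω).symm '' E)) := by
      intro x hx
      induction hx using AddSubmonoid.closure_induction with
      | mem x hx => exact PointedCone.subset_hull ⟨_, ⟨x, hx, rfl⟩, rfl⟩
      | zero =>
        simp only [map_zero, Pi.zero_apply, Rat.cast_zero]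
        exact Submodule.zero_mem _
      | add x y _ _ hx hy =>
        simp only [map_add, Pi.add_apply, Rat.cast_add]
        exact Submodule.add_mem _ hx hy
    simpa using this _ hv

end Monoid

/-! ### The series of an `ω`-sequence -/

section Series

variable {N M : ℕ} {K : Type*} [Field K] {ω : Fin N → ℝ} (hω : LinearIndependent ℚ ω)
  {I : Ideal (LaurentPoly N M K)} {S : ℕ → OmegaSet ω M K}

/-- The condition `η^{(n+1)}_i > dΓ^{(n)} η^{(n)}_i` says that the exponents of the summands of
`ser(S)` increase. -/
theorem IsOmegaSequence.step (hS : IsOmegaSequence I S) {n : ℕ} {i : Fin M}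
    (h : (S (n + 1)).c i ≠ 0) :
    (S n).c i ≠ 0 ∧ serExpo hω S i n < serExpo hω S i (n + 1) := by
  have hlt := hS.2 n i (((S (n + 1)).coeff_ne_zero_iff i).1 h)
  have hn : (S n).c i ≠ 0 := by
    intro h0
    rw [(S n).η_eq_top h0] at hlt
    obtain ⟨k, hk⟩ := Nat.exists_eq_succ_of_ne_zero (S n).d_pos.ne'
    rw [hk, succ_nsmul, WithTop.add_top] at hlt
    exact not_top_lt hlt
  refine ⟨hn, ?_⟩
  rw [(S n).η_eq hn, (S (n + 1)).η_eq h, ← WithTop.coe_nsmul, WithTop.coe_lt_coe,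
    nsmul_eq_mul] at hlt
  have hd : (0 : ℝ) < (S n).d := by exact_mod_cast (S n).d_pos
  have hr : (0 : ℝ) < ramification S n := by exact_mod_cast ramification_pos S n
  rw [expo_lt_iff, serExpo, serExpo, dot_smul_expo, dot_smul_expo, ramification_succ]
  push_cast
  rw [div_mul_eq_mul_div, lt_div_iff₀ hd, mul_assoc]
  refine mul_lt_mul_of_pos_left ?_ hr
  rwa [mul_comm]

theorem IsOmegaSequence.lt (hS : IsOmegaSequence I S) {m n : ℕ} (hmn : m < n) {i : Fin M}
    (h : (S n).c i ≠ 0) : (S m).c i ≠ 0 ∧ serExpo hω S i m < serExpo hω S i n := by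
  induction n, hmn using Nat.le_induction with
  | base => exact hS.step hω h
  | succ n _ ih =>
    obtain ⟨h1, h2⟩ := hS.step hω h
    exact ⟨(ih h1).1, (ih h1).2.trans h2⟩

theorem IsOmegaSequence.le (hS : IsOmegaSequence I S) {m n : ℕ} (hmn : m ≤ n) {i : Fin M}
    (h : (S n).c i ≠ 0) : (S m).c i ≠ 0 ∧ serExpo hω S i m ≤ serExpo hω S i n := by
  rcases hmn.eq_or_lt with rfl | hlt
  · exact ⟨h, le_rfl⟩
  · exact ⟨(hS.lt hω hlt h).1, (hS.lt hω hlt h).2.le⟩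

theorem coeff_single_serExpo (n : ℕ) (i : Fin M) (v : Fin N → ℚ) :
    (HahnSeries.single (serExpo hω S i n) ((S n).c i)).coeff (toExpo ω hω v) =
      serTerm S n i v := by
  classical
  rw [serTerm, OmegaSet.tuple, HahnSeries.coeff_single, Pi.single_apply]
  by_cases h : v = ramification S n • (S n).expo i
  · rw [if_pos (by rw [h]; rfl), if_pos h]
  · rw [if_neg h, if_neg fun h' : toExpo ω hω v = serExpo hω S i n =>
      h ((toExpo ω hω).injective h')]

/-- The only exponent that can occur in a summand of `ser(S)` is `serExpo`. -/
theorem serTerm_ne_zero {n : ℕ} {i : Fin M} {v : Fin N → ℚ} (h : serTerm S n i v ≠ 0) :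
    (S n).c i ≠ 0 ∧ toExpo ω hω v = serExpo hω S i n := by
  rw [← coeff_single_serExpo hω] at h
  refine ⟨fun h0 => h (by simp [h0]), ?_⟩
  by_contra hne
  exact h (HahnSeries.coeff_single_of_ne hne)

theorem IsOmegaSequence.finite_serTerm_ne_zero (hω : LinearIndependent ℚ ω)
    (hS : IsOmegaSequence I S) (i : Fin M) (v : Fin N → ℚ) :
    {n : ℕ | serTerm S n i v ≠ 0}.Finite := by
  refine Set.Subsingleton.finite fun m hm n hn => ?_
  obtain ⟨hm1, hm2⟩ := serTerm_ne_zero hω hm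
  obtain ⟨hn1, hn2⟩ := serTerm_ne_zero hω hn
  have heq := hm2.symm.trans hn2
  rcases lt_trichotomy m n with h | h | h
  · exact absurd heq (hS.lt hω h hn1).2.ne
  · exact h
  · exact absurd heq (hS.lt hω h hm1).2.ne'

theorem exists_serTerm_ne_zero {i : Fin M} {v : Fin N → ℚ} (h : ser S i v ≠ 0) :
    ∃ n, serTerm S n i v ≠ 0 := by
  by_contra! h0
  exact h (by simp [ser, h0])

/-- The `i`-th entry of `ser(S)` as a Hahn series. -/
def serHahn (hS : IsOmegaSequence I S) (i : Fin M) : HahnSeries (Expo ω hω) K where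
  coeff e := ser S i ((toExpo ω hω).symm e)
  isPWO_support' := by
    have h : ({n : ℕ | (S n).c i ≠ 0}).IsPWO := Set.IsWF.isPWO (Set.IsWF.of_wellFoundedLT _)
    refine (h.image_of_monotoneOn (f := serExpo hω S i) fun m _ n hn hmn =>
      (hS.le hω hmn hn).2).mono ?_
    intro e he
    obtain ⟨n, hn⟩ := exists_serTerm_ne_zero he
    obtain ⟨h1, h2⟩ := serTerm_ne_zero hω hn
    exact ⟨n, h1, by rw [← h2, AddEquiv.apply_symm_apply]⟩

theorem coeff_serHahn (hS : IsOmegaSequence I S) (i : Fin M) (v : Fin N → ℚ) :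
    (serHahn hω hS i).coeff (toExpo ω hω v) = ser S i v := by
  change ser S i _ = _
  rw [AddEquiv.symm_apply_apply]

theorem coeff_serPartial (n : ℕ) (i : Fin M) (v : Fin N → ℚ) :
    (serPartial hω S n i).coeff (toExpo ω hω v) = ∑ j ∈ Finset.range n, serTerm S j i v := by
  rw [serPartial, partialSum, HahnSeries.coeff_sum]
  exact Finset.sum_congr rfl fun j _ => coeff_single_serExpo hω j i v

theorem coeff_serHahn_sub (hS : IsOmegaSequence I S) {n : ℕ} {i : Fin M} {v : Fin N → ℚ}
    (h : ∀ j, n ≤ j → serTerm S j i v = 0) :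
    (serHahn hω hS i - serPartial hω S n i).coeff (toExpo ω hω v) = 0 := by
  rw [HahnSeries.coeff_sub, coeff_serHahn, coeff_serPartial, ser,
    finsum_eq_sum_of_support_subset, sub_self]
  intro j hj
  by_contra hjn
  exact hj (h j (by simpa using hjn))

/-- Once a coordinate has coefficient `0`, its series has terminated. -/
theorem serHahn_eq_serPartial (hS : IsOmegaSequence I S) {n : ℕ} {i : Fin M}
    (h : (S n).c i = 0) : serHahn hω hS i = serPartial hω S n i := by
  rw [← sub_eq_zero]
  ext e
  obtain ⟨v, rfl⟩ := (toExpo ω hω).surjective e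
  refine coeff_serHahn_sub hω hS fun j hj => ?_
  by_contra hne
  exact (hS.le hω hj (serTerm_ne_zero hω hne).1).1 h

theorem le_orderTop_serHahn_sub (hS : IsOmegaSequence I S) (n : ℕ) (i : Fin M) :
    (serExpo hω S i n : WithTop (Expo ω hω)) ≤
      (serHahn hω hS i - serPartial hω S n i).orderTop := by
  rw [HahnSeries.le_orderTop_iff_forall]
  intro e he
  obtain ⟨v, rfl⟩ := (toExpo ω hω).surjective e
  refine coeff_serHahn_sub hω hS fun j hj => ?_
  by_contra hne
  obtain ⟨h1, h2⟩ := serTerm_ne_zero hω hne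
  rw [h2, WithTop.coe_lt_coe] at he
  exact absurd he (not_lt.2 (hS.le hω hj h1).2)

theorem le_orderTop_serPartial (hS : IsOmegaSequence I S) (n : ℕ) (i : Fin M) :
    (serExpo hω S i 0 : WithTop (Expo ω hω)) ≤ (serPartial hω S n i).orderTop := by
  rw [serPartial, partialSum]
  refine le_orderTop_sum fun j _ => ?_
  by_cases h : (S j).c i = 0
  · simp [h]
  · exact (WithTop.coe_le_coe.2 (hS.le hω (Nat.zero_le j) h).2).trans
      HahnSeries.orderTop_single_le

/-- The exponents of a coordinate of `ser(S)` that does not terminate: the Newton–Puiseux theorem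
applied to a polynomial of the ideal in `y_i` alone. -/
theorem IsOmegaSequence.exists_closure [IsAlgClosed K] [CharZero K] (hS : IsOmegaSequence I S)
    (hI : IsAdmissible I) {i : Fin M} (hi : ∀ n, (S n).c i ≠ 0) :
    ∃ n₀, ∃ E : Set (Expo ω hω), E.Finite ∧ (∀ e ∈ E, 0 ≤ e) ∧
      ∀ n, n₀ ≤ n → serExpo hω S i n - serExpo hω S i n₀ ∈ AddSubmonoid.closure E := by
  obtain ⟨q, hq, hqI⟩ := exists_univariate_mem hI i
  refine exists_closure_of_initialVanishes (p := q.map (dilate ω hω 1).toRingHom) ?_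
    (strictMono_nat_of_lt_succ fun n => (hS.step hω (hi (n + 1))).2) hi ?_ ?_
  · rwa [Ne, Polynomial.map_eq_zero_iff (dilate_injective ω hω one_ne_zero)]
  · intro k
    rw [Polynomial.coeff_map]
    exact dilate_mem_finiteSupport ω hω 1 _
  · intro n
    have h := hS.mvInitialVanishes hω hqI n
    rw [toHahn_toMvPolynomial, translate_toMvPolynomial] at h
    exact h.univariate

open Filter in
/-- In each coordinate the sequence terminates, or the orders of its summands tend to infinity. -/
theorem IsOmegaSequence.eventually_lt [IsAlgClosed K] [CharZero K] (hS : IsOmegaSequence I S)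
    (hI : IsAdmissible I) (i : Fin M) (B : Expo ω hω) :
    ∀ᶠ n in atTop, (S n).c i = 0 ∨ B < serExpo hω S i n := by
  by_cases hi : ∀ n, (S n).c i ≠ 0
  · obtain ⟨n₀, E, hfin, hE, hcl⟩ := hS.exists_closure hω hI hi
    have hmono : StrictMono (serExpo hω S i) :=
      strictMono_nat_of_lt_succ fun n => (hS.step hω (hi (n + 1))).2
    have hbad : {n | n₀ ≤ n ∧ serExpo hω S i n ≤ B}.Finite := by
      refine Set.Finite.of_finite_image (f := fun n => serExpo hω S i n - serExpo hω S i n₀)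
        ((finite_closure_le hω hfin hE (B - serExpo hω S i n₀)).subset ?_) ?_
      · rintro _ ⟨n, ⟨hn, hB⟩, rfl⟩
        exact ⟨hcl n hn, sub_le_sub_right hB _⟩
      · intro m _ n _ h
        exact hmono.injective (sub_left_injective h)
    filter_upwards [eventually_ge_atTop n₀,
      Nat.cofinite_eq_atTop ▸ hbad.eventually_cofinite_notMem] with n hn hn'
    right
    by_contra! h
    exact hn' ⟨hn, h⟩
  · push Not at hi
    obtain ⟨m, hm⟩ := hi
    filter_upwards [eventually_ge_atTop m] with n hn
    left
    by_contra h
    exact (hS.le hω hn h).1 hm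

open Pointwise in
theorem serHahn_mem [IsAlgClosed K] [CharZero K] (hS : IsOmegaSequence I S)
    (hI : IsAdmissible I) (i : Fin M) : serHahn hω hS i ∈ PuiseuxField ω hω K := by
  by_cases hi : ∀ n, (S n).c i ≠ 0
  · obtain ⟨n₀, E, hfin, hE, hcl⟩ := hS.exists_closure hω hI hi
    have hsub : exponents (serHahn hω hS i) ⊆
        (toExpo ω hω).symm '' (serExpo hω S i '' Set.Iio n₀) ∪
          ({(toExpo ω hω).symm (serExpo hω S i n₀)} +
            {v | toExpo ω hω v ∈ AddSubmonoid.closure E}) := by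
      intro v hv
      rw [exponents, Set.mem_ofPred_eq, coeff_serHahn] at hv
      obtain ⟨n, hn⟩ := exists_serTerm_ne_zero hv
      obtain ⟨-, h⟩ := serTerm_ne_zero hω hn
      rcases lt_or_ge n n₀ with hlt | hge
      · exact Or.inl ⟨_, ⟨n, hlt, rfl⟩, by rw [← h, AddEquiv.symm_apply_apply]⟩
      · refine Or.inr ⟨_, rfl, v - (toExpo ω hω).symm (serExpo hω S i n₀), ?_, ?_⟩
        · rw [Set.mem_ofPred_eq, map_sub, h, AddEquiv.apply_symm_apply]
          exact hcl n hge
        · exact add_sub_cancel _ _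
    have hfin' : ((toExpo ω hω).symm '' (serExpo hω S i '' Set.Iio n₀)).Finite :=
      ((Set.finite_Iio n₀).image _).image _
    exact ⟨((inLattice_of_finite hfin').union
        ((inLattice_singleton _).add (inLattice_closure hω hfin))).mono hsub,
      ((inPositiveCone_of_finite hfin').union
        ((inPositiveCone_singleton ω _).add (inPositiveCone_closure hω hfin hE))).mono hsub⟩
  · push Not at hi
    obtain ⟨n, hn⟩ := hi
    have hfin : (exponents (serHahn hω hS i)).Finite := by
      have h : serHahn hω hS i ∈ finiteSupport (Expo ω hω) K := by
        rw [serHahn_eq_serPartial hω hS hn, serPartial, partialSum]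
        exact Subring.sum_mem _ fun j _ => single_mem_finiteSupport _ _
      exact Set.Finite.preimage (toExpo ω hω).injective.injOn h
    exact ⟨inLattice_of_finite hfin, inPositiveCone_of_finite hfin⟩

open Filter in
/-- Suppose `f(ser(S))` had finite order `l`. For large `n` the remaining summands are of such large
order that `f(x, y + φ_n)` takes the same value modulo terms of order greater than `l` at the
remainder of the series, at its leading monomials, and at `0`; moreover its weighted order is at
least `l`. The vanishing of the initial form then makes the coefficient of order `l` zero. -/
theorem eval_serHahn_eq_zero [IsAlgClosed K] [CharZero K] (hS : IsOmegaSequence I S)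
    (hI : IsAdmissible I) {f : LaurentPoly N M K} (hf : f ∈ I) :
    MvPolynomial.eval (serHahn hω hS) (toHahn ω hω 1 f) = 0 := by
  by_contra hne
  set y := MvPolynomial.eval (serHahn hω hS) (toHahn ω hω 1 f) with hy
  set l := y.order with hl
  obtain ⟨C, hC⟩ := exists_le_orderTop_coeff_translate (toHahn ω hω 1 f)
    (fun i => serExpo hω S i 0)
  set B := max 0 (l - C) with hB
  have hB0 : 0 ≤ B := le_max_left _ _
  have hlB : l ≤ C + B := sub_le_iff_le_add'.1 (le_max_right _ _)
  obtain ⟨n, hn⟩ := (eventually_all.2 fun i => hS.eventually_lt hω hI i B).exists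
  set G := translate (serPartial hω S n) (toHahn ω hω 1 f) with hG
  have hGC : ∀ β, (C : WithTop (Expo ω hω)) ≤ (G.coeff β).orderTop :=
    hC _ (le_orderTop_serPartial hω hS n)
  have h1 : ∀ e ≤ l, y.coeff e = (G.coeff 0).coeff e := by
    intro e he
    have : y = MvPolynomial.eval (serHahn hω hS - serPartial hω S n) G := by
      rw [hG, eval_translate, sub_add_cancel]
    rw [this]
    refine coeff_eval_eq_coeff_zero hGC hB0 hlB (fun i => ?_) he
    rcases hn i with h | h
    · rw [Pi.sub_apply, serHahn_eq_serPartial hω hS h, sub_self, HahnSeries.orderTop_zero]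
      exact WithTop.coe_lt_top _
    · exact (WithTop.coe_lt_coe.2 h).trans_le (le_orderTop_serHahn_sub hω hS n i)
  have h2 : (MvPolynomial.eval (fun i => HahnSeries.single (serExpo hω S i n) ((S n).c i))
      G).coeff l = (G.coeff 0).coeff l := by
    refine coeff_eval_eq_coeff_zero hGC hB0 hlB (fun i => ?_) le_rfl
    rcases hn i with h | h
    · rw [h, HahnSeries.single_eq_zero, HahnSeries.orderTop_zero]
      exact WithTop.coe_lt_top _
    · exact HahnSeries.lt_orderTop_single h
  have h3 : MvWeightGE G (fun i => serExpo hω S i n) (S n).c l := by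
    intro β hβ
    by_cases h0 : β = 0
    · subst h0
      rw [HahnSeries.le_orderTop_iff_forall]
      intro e he
      have he' : e < l := by simpa using he
      rw [← h1 e he'.le]
      exact HahnSeries.coeff_eq_zero_of_lt_order he'
    · refine le_trans (WithTop.coe_le_coe.2 ?_) (hGC β)
      rw [sub_le_iff_le_add]
      refine hlB.trans (add_le_add_right ?_ C)
      obtain ⟨i, hi⟩ := Finsupp.ne_iff.1 h0
      have hpos : ∀ j, β j ≠ 0 → B < serExpo hω S j n := fun j hj =>
        (hn j).resolve_left fun h => hj (hβ j h)
      have hterm : ∀ j, 0 ≤ β j • serExpo hω S j n := by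
        intro j
        by_cases hj : β j = 0
        · simp [hj]
        · exact nsmul_nonneg (hB0.trans (hpos j hj).le) _
      calc B ≤ serExpo hω S i n := (hpos i hi).le
        _ ≤ β i • serExpo hω S i n :=
          le_self_nsmul (hB0.trans (hpos i hi).le) hi
        _ ≤ _ := Finset.single_le_sum (f := fun j => β j • serExpo hω S j n)
          (fun j _ => hterm j) (Finset.mem_univ i)
  have h4 := hS.mvInitialVanishes hω hf n l h3
  rw [h2, ← h1 l le_rfl, hl, HahnSeries.coeff_order_eq_zero] at h4
  exact hne h4

end Series

end OmegaPuiseux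

end

theorem mainTheorem2 {K : Type*} [Field K] [IsAlgClosed K] [CharZero K] {N M : ℕ}
    (ω : Fin N → ℝ) (hω : LinearIndependent ℚ ω)
    (I : Ideal (OmegaPuiseux.LaurentPoly N M K)) (hI : OmegaPuiseux.IsAdmissible I)
    (S : ℕ → OmegaPuiseux.OmegaSet ω M K) (hS : OmegaPuiseux.IsOmegaSequence I S) :
    (∀ i α, {n : ℕ | OmegaPuiseux.serTerm S n i α ≠ 0}.Finite) ∧
      OmegaPuiseux.IsOmegaSolution ω hω I (OmegaPuiseux.ser S) := by
  open OmegaPuiseux in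
  refine ⟨fun i α => hS.finite_serTerm_ne_zero hω i α,
    fun i => ⟨serHahn hω hS i, serHahn_mem hω hS hI i⟩, ?_, fun i α => coeff_serHahn hω hS i α⟩
  set ψ : Fin M → PuiseuxField ω hω K :=
    fun i => ⟨serHahn hω hS i, serHahn_mem hω hS hI i⟩ with hψ
  have hle : extendedIdeal ω hω I ≤ RingHom.ker (MvPolynomial.eval ψ) := by
    rw [extendedIdeal, Ideal.map_le_iff_le_comap]
    intro f hf
    rw [Ideal.mem_comap, RingHom.mem_ker]
    apply Subtype.ext
    have hhom : ((PuiseuxField ω hω K).val.toRingHom.comp (MvPolynomial.eval ψ)).comp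
        (MvPolynomial.map (laurentToPuiseux (K := K) ω hω).toRingHom) =
        (MvPolynomial.eval (serHahn hω hS)).comp (toHahn ω hω 1) := by
      refine MvPolynomial.ringHom_ext (fun g => ?_) (fun i => ?_)
      · simpa [toHahn] using coe_laurentToPuiseux ω hω g
      · simp [toHahn, hψ]
    exact (DFunLike.congr_fun hhom f).trans (eval_serHahn_eq_zero hω hS hI hf)
  exact fun f hf => hle hf
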